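/- **Setting.** Let $\Omega\subset\mathbb R^2$ be a bounded convex polygonal domain, $\zeta\in[W^{1,\infty}(\Omega)]^2$ and $\gamma\in W^{1,\infty}(\Omega)$ with $\gamma\ge 0$; let $\varepsilon$ satisfy $\varepsilon\ge\varepsilon_0>0$ a.e. in $\Omega$, and suppose $\gamma-\tfrac12\nabla\cdot\zeta\ge\gamma_0>0$ a.e. in $\Omega$. Let $\mathcal T_h$ be a conforming triangulation of $\Omega$ with mesh size $h=\max_{T\in\mathcal T_h} h_T$, $h_T=\operatorname{diam}T$, that is shape-regular with constant $\sigma$ (each $T$ contains a ball of radius $r>0$ with $h_T\le\sigma r$), and assume that $\varepsilon\in W^{1,\infty}(T)$ for all $T\in\mathcal T_h$, with $\varepsilon$ and its first weak partial derivatives bounded by $M$ a.e. on $T$. Let $V_h\subset H^1_0(\Omega)$ be the space of continuous functions that are affine on each $T\in\mathcal T_h$ and vanish on $\partial\Omega$. For a triangle $T\in\mathcal T_h$ and an edge $E\subset\partial T$ with endpoints $\mathbf x_i,\mathbf x_j$, $\tau_E=\mathbf x_j-\mathbf x_i$, let $$\psi_E(\mathbf x_i+t\tau_E)=\int_0^t(\varepsilon^{-1}\zeta\cdot\tau_E)(\mathbf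 x_i+s\tau_E)\,ds,\qquad \kappa_E=\varepsilon e^{-\psi_E},\qquad H(\kappa_E)=\Big(\frac1{|E|}\int_E\kappa_E^{-1}\,ds\Big)^{-1},$$ with the traces of $\varepsilon|_T$ and $\zeta$ on $E$, let $\delta_E(w)=w(\mathbf x_j)-w(\mathbf x_i)$ and $\omega_E^T=-\int_T\nabla\lambda_i\cdot\nabla\lambda_j\,d\mathbf x$ with $\lambda_i$ the barycentric coordinates of $T$, and put $$a_h^{0}(y,v)=\sum_{T\in\mathcal T_h}\sum_{E\subset\partial T}\omega_E^T\,H(\kappa_E)\,\delta_E(e^{\psi_E}y)\,\delta_E(v),\qquad a_h^{\gamma}(y,v)=a_h^0(y,v)+\int_\Omega\gamma\,y\,v\,d\mathbf x .$$ For $a_h\in\{a_h^0,a_h^\gamma\}$ let $$\mathcal B_h((p,y),(q,z))=a_h(q,p)-(y,q)_{L^2(\Omega)}-(p,z)_{L^2(\Omega)}-a_h(y,z).$$ **Lemma.** There exist constants $C>0$ and $h_0>0$, depending only on $\Omega,\varepsilon,\zeta,\gamma,\varepsilon_0,\gamma_0,\sigma$ and $M$ (and not on $h$ or $\mathcal T_h$),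 such that for every such triangulation with $h\le h_0$ and for either choice of $a_h$ the following holds. 1. For all $(p_h,y_h)\in V_h\times V_h$, $$\sup_{(q_h,z_h)\in V_h\times V_h}\frac{\mathcal B_h((p_h,y_h),(q_h,z_h))}{\|q_h\|_{H^1(\Omega)}+\|z_h\|_{H^1(\Omega)}}\ \ge\ C\left(\|p_h\|_{H^1(\Omega)}+\|y_h\|_{H^1(\Omega)}\right),$$ where the supremum is finite, and the quotient is read as $0$ for $(q_h,z_h)=(0,0)$. 2. The discrete problem is well posed: for every $y_d\in L^2(\Omega)$ there is exactly one $(\bar p_h,\bar y_h)\in V_h\times V_h$ with $$\mathcal B_h((\bar p_h,\bar y_h),(q_h,z_h))=-(y_d,q_h)_{L^2(\Omega)}\qquad\text{for all }(q_h,z_h)\in V_h\times V_h,$$ and it satisfies $C\left(\|\bar p_h\|_{H^1(\Omega)}+\|\bar y_h\|_{H^1(\Omega)}\right)\le\|y_d\|_{L^2(\Omega)}$. -/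

import Mathlib

open MeasureTheory Set
open scoped ContDiff RealInnerProductSpace

noncomputable section

namespace EAFE

/-- The Euclidean plane. -/
abbrev Plane : Type := EuclideanSpace ℝ (Fin 2)

/-! ### The domain and weak derivatives -/

/-- A (bounded, open) convex polygonal domain: the nonempty interior of the convex hull of
finitely many points. -/
def IsConvexPolygonalDomain (Ω : Set Plane) : Prop :=
  Ω.Nonempty ∧ ∃ S : Finset Plane, Ω = interior (convexHull ℝ (S : Set Plane))

/-- Test functions on `U`: smooth, with compact support contained in `U`. -/
def IsTestFunction (U : Set Plane) (φ : Plane → ℝ) : Prop :=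
  ContDiff ℝ ∞ φ ∧ HasCompactSupport φ ∧ tsupport φ ⊆ U

/-- `g` is the weak partial derivative `∂ᵢ f` on the open set `U`. -/
def HasWeakPartial (U : Set Plane) (f : Plane → ℝ) (i : Fin 2) (g : Plane → ℝ) : Prop :=
  LocallyIntegrableOn f U ∧ LocallyIntegrableOn g U ∧
    ∀ φ : Plane → ℝ, IsTestFunction U φ →
      ∫ x in U, f x * fderiv ℝ φ x (EuclideanSpace.single i 1) = -∫ x in U, g x * φ x

/-- `d` is the weak divergence of the vector field `ζ` on the open set `U`. -/
def HasWeakDivergence (U : Set Plane) (ζ : Plane → Plane) (d : Plane → ℝ) : Prop :=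
  LocallyIntegrableOn ζ U ∧ LocallyIntegrableOn d U ∧
    ∀ φ : Plane → ℝ, IsTestFunction U φ →
      ∫ x in U, ⟪ζ x, gradient φ x⟫ = -∫ x in U, d x * φ x

/-- `f ∈ W^{1,∞}(U)`, and `f` and its first weak partial derivatives are bounded by `M` almost
everywhere on `U`. -/
def HasW1InfBound (U : Set Plane) (f : Plane → ℝ) (M : ℝ) : Prop :=
  AEStronglyMeasurable f (volume.restrict U) ∧
    (∀ᵐ x ∂volume.restrict U, |f x| ≤ M) ∧
    ∀ i : Fin 2, ∃ g : Plane → ℝ, AEStronglyMeasurable g (volume.restrict U) ∧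
      (∀ᵐ x ∂volume.restrict U, |g x| ≤ M) ∧ HasWeakPartial U f i g

/-- The Sobolev space `W^{1,∞}(U)`. -/
def MemW1Inf (U : Set Plane) (f : Plane → ℝ) : Prop :=
  ∃ M : ℝ, HasW1InfBound U f M

/-! ### Triangulations -/

/-- A nondegenerate triangle, given by its three affinely independent vertices. As an affine basis
of the plane it carries its barycentric coordinates `T.coord i`. -/
abbrev Triangle : Type := AffineBasis (Fin 3) ℝ Plane

/-- The closed triangle as a point set. -/
def Triangle.carrier (T : Triangle) : Set Plane :=
  convexHull ℝ (range T)

/-- A conforming triangulation of `Ω`: finitely many closed triangles with union `closure Ω`, any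
two of which have disjoint interiors and meet exactly in the convex hull of their common vertices
(the empty set, a common vertex or a common edge). -/
structure Triangulation (Ω : Set Plane) where
  elems : Finset Triangle
  cover : ⋃ T ∈ elems, T.carrier = closure Ω
  disjoint_interior : ∀ T ∈ elems, ∀ T' ∈ elems, T ≠ T' →
    Disjoint (interior T.carrier) (interior T'.carrier)
  conforming : ∀ T ∈ elems, ∀ T' ∈ elems, T ≠ T' →
    T.carrier ∩ T'.carrier = convexHull ℝ (range T ∩ range T')

variable {Ω : Set Plane}

/-- The mesh size `h = max_T h_T`, with `h_T` the diameter of `T`. -/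
def Triangulation.meshSize (𝒯 : Triangulation Ω) : ℝ :=
  ⨆ T : 𝒯.elems, Metric.diam (T : Triangle).carrier

/-- Shape regularity with constant `σ`: each element `T` contains a ball of radius `r > 0` with
`h_T ≤ σ r`. -/
def Triangulation.ShapeRegular (𝒯 : Triangulation Ω) (σ : ℝ) : Prop :=
  ∀ T ∈ 𝒯.elems, ∃ c : Plane, ∃ r : ℝ, 0 < r ∧ Metric.ball c r ⊆ T.carrier ∧
    Metric.diam T.carrier ≤ σ * r

/-- The space `V_h ⊂ H¹₀(Ω)` of continuous functions that are affine on each element and vanish on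
the boundary of `Ω`. Its members are extended by zero outside `Ω`. -/
def Triangulation.femSpace (𝒯 : Triangulation Ω) : Submodule ℝ (Plane → ℝ) where
  carrier := {v | Continuous v ∧ (∀ x, x ∉ Ω → v x = 0) ∧
    ∀ T ∈ 𝒯.elems, ∃ ℓ : Plane →ᵃ[ℝ] ℝ, EqOn v ℓ T.carrier}
  zero_mem' := ⟨continuous_zero, fun _ _ => rfl, fun _ _ => ⟨0, fun _ _ => rfl⟩⟩
  add_mem' := by
    rintro u v ⟨hu, hu0, hul⟩ ⟨hv, hv0, hvl⟩
    refine ⟨hu.add hv, fun x hx => ?_, fun T hT => ?_⟩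
    · simp [hu0 x hx, hv0 x hx]
    · obtain ⟨ℓ, hl⟩ := hul T hT
      obtain ⟨m, hm⟩ := hvl T hT
      exact ⟨ℓ + m, fun x hx => by simp [hl hx, hm hx]⟩
  smul_mem' := by
    rintro c v ⟨hv, hv0, hvl⟩
    refine ⟨hv.const_smul c, fun x hx => ?_, fun T hT => ?_⟩
    · simp [hv0 x hx]
    · obtain ⟨m, hm⟩ := hvl T hT
      exact ⟨c • m, fun x hx => by simp [hm hx]⟩

/-! ### Inner products and norms -/

/-- The `L²(Ω)` inner product. -/
def l2Inner (Ω : Set Plane) (f g : Plane → ℝ) : ℝ :=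
  ∫ x in Ω, f x * g x

/-- The `L²(Ω)` norm. -/
def l2Norm (Ω : Set Plane) (f : Plane → ℝ) : ℝ :=
  Real.sqrt (l2Inner Ω f f)

/-- The `H¹(Ω)` norm. It is used for continuous piecewise affine functions only; for these the
classical gradient exists almost everywhere and is the weak gradient. -/
def h1Norm (Ω : Set Plane) (v : Plane → ℝ) : ℝ :=
  Real.sqrt ((∫ x in Ω, v x ^ 2) + ∫ x in Ω, ‖gradient v x‖ ^ 2)

/-! ### The edge-averaged finite element form -/

/-- The edge potential at the point `x₀ + t (x₁ - x₀)` of the edge from `x₀` to `x₁`, normalised to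
vanish at `x₀`. In the normalised parameter `s` the mean `|L|⁻¹ ∫_L · ds` is the integral over
`[0,1]`. -/
def edgePotential (ε : Plane → ℝ) (ζ : Plane → Plane) (x₀ x₁ : Plane) (t : ℝ) : ℝ :=
  ∫ s in (0 : ℝ)..t, (ε (AffineMap.lineMap x₀ x₁ s))⁻¹ * ⟪ζ (AffineMap.lineMap x₀ x₁ s), x₁ - x₀⟫

/-- `κ_E = ε exp(-ψ_E)` at the point `x₀ + t (x₁ - x₀)` of the edge. -/
def edgeKappa (ε : Plane → ℝ) (ζ : Plane → Plane) (x₀ x₁ : Plane) (t : ℝ) : ℝ :=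
  ε (AffineMap.lineMap x₀ x₁ t) * Real.exp (-edgePotential ε ζ x₀ x₁ t)

/-- The harmonic average `H(κ_E)` over the edge. -/
def harmonicAverage (ε : Plane → ℝ) (ζ : Plane → Plane) (x₀ x₁ : Plane) : ℝ :=
  (∫ t in (0 : ℝ)..1, (edgeKappa ε ζ x₀ x₁ t)⁻¹)⁻¹

/-- The difference `δ_E(exp(ψ_E) y)` of the endpoint values. -/
def edgeDelta (ε : Plane → ℝ) (ζ : Plane → Plane) (x₀ x₁ : Plane) (y : Plane → ℝ) : ℝ :=
  Real.exp (edgePotential ε ζ x₀ x₁ 1) * y x₁ - Real.exp (edgePotential ε ζ x₀ x₁ 0) * y x₀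

/-- The edge weight `ω_E^T = -∫_T ∇λᵢ · ∇λⱼ` of the edge joining vertices `i` and `j` of `T`. -/
def edgeWeight (T : Triangle) (i j : Fin 3) : ℝ :=
  -∫ x in T.carrier, ⟪gradient (fun w => T.coord i w) x, gradient (fun w => T.coord j w) x⟫

/-- The local form `a_h^T`: the sum over the three edges, joining vertices `i` and `i + 1`
(cyclically), of `ω_E^T H(κ_E) δ_E(exp(ψ_E) y) δ_E(v)`. -/
def localForm (T : Triangle) (ε : Plane → ℝ) (ζ : Plane → Plane) (y v : Plane → ℝ) : ℝ :=
  ∑ i : Fin 3, edgeWeight T i (i + 1) * harmonicAverage ε ζ (T i) (T (i + 1)) *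
    edgeDelta ε ζ (T i) (T (i + 1)) y * (v (T (i + 1)) - v (T i))

/-- The global edge-averaged form `∑_T a_h^T`. On the element `T` the diffusion coefficient is
`e T`, the continuous representative on `T`. -/
def eafeForm (𝒯 : Triangulation Ω) (e : Triangle → Plane → ℝ) (ζ : Plane → Plane)
    (y v : Plane → ℝ) : ℝ :=
  ∑ T ∈ 𝒯.elems, localForm T (e T) ζ y v

/-- The edge-averaged form together with the reaction term `∫_Ω γ y v`. -/
def eafeReactionForm (𝒯 : Triangulation Ω) (e : Triangle → Plane → ℝ) (ζ : Plane → Plane)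
    (γ : Plane → ℝ) (y v : Plane → ℝ) : ℝ :=
  eafeForm 𝒯 e ζ y v + ∫ x in Ω, γ x * y x * v x

/-- On each element `T` of the mesh, `e T` is the representative of `ε` that is continuous up to
the boundary of `T`, and `ε ∈ W^{1,∞}(T)` with bound `M`. -/
def IsElementwiseW1Inf (𝒯 : Triangulation Ω) (ε : Plane → ℝ) (e : Triangle → Plane → ℝ)
    (M : ℝ) : Prop :=
  ∀ T ∈ 𝒯.elems, ContinuousOn (e T) T.carrier ∧
    (∀ᵐ x ∂volume.restrict T.carrier, e T x = ε x) ∧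
    HasW1InfBound (interior T.carrier) ε M

/-- The saddle-point form
`ℬ((p,y),(q,z)) = a(q,p) - (y,q) - (p,z) - a(y,z)` built from a form `a`. -/
def saddleForm (Ω : Set Plane) (a : (Plane → ℝ) → (Plane → ℝ) → ℝ) (p y q z : Plane → ℝ) : ℝ :=
  a q p - l2Inner Ω y q - l2Inner Ω p z - a y z

end EAFE

end

open EAFE

noncomputable section

namespace EAFE

/-! Everything rests on a discrete Gårding inequality, uniform in small meshes: `ε₀/2 ‖v‖²_{H¹} ≤
a(v,v) + K ‖v‖²_{L²}` on `V_h`. The saddle-point structure supplies the missing `K ‖v‖²`: testing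
with `(p - K y, -y - K p)` cancels all cross terms and leaves exactly `a(p,p) + K‖p‖² + a(y,y) +
K‖y‖²` (`le_saddleMap_saddleTest`). Since the test pair is bounded by a multiple of `(p, y)`, this
gives the inf-sup bound and the a priori estimate; solvability follows because the discrete system
is square.

Gårding's inequality is proved triangle by triangle (`exists_localForm_lower_bound`). With `ψ`
vanishing at the first endpoint, `δ(e^ψ v) = δ(v) + (e^{ψ(1)} - 1) v(x₁)`. On an edge of length at
most `h` the potential is `O(h)`, and `ε` is Lipschitz on the triangle, so `H(κ_E)` is within `O(h)`
of one vertex value `m` of `ε` and `H(κ_E)(e^{ψ(1)} - 1) = O(h)` (`edge_bounds`). Replacing every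
`H(κ_E)` by `m` produces `m |T| |∇v|²`, the Dirichlet energy. Shape regularity bounds the errors by
`O(h)|T||∇v|²` and by `|T||v||∇v|`; the latter is split by Young's inequality
(`sum_edge_lower_bound`). The weights are used only through their absolute values, so no angle
condition on the mesh enters. -/

/-! ### From weak derivatives to Lipschitz bounds -/

/-- The function agrees almost everywhere with its truncation `min f c`, and continuous functions
that agree almost everywhere on an open set agree on it everywhere. -/
theorem le_of_ae_le_of_isOpen {U : Set Plane} (hU : IsOpen U) {f : Plane → ℝ} {c : ℝ}
    (hf : ContinuousOn f U) (h : ∀ᵐ x ∂volume.restrict U, f x ≤ c) : ∀ x ∈ U, f x ≤ c := by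
  have h1 : f =ᵐ[volume.restrict U] fun x => min (f x) c := by
    filter_upwards [h] with x hx
    rw [min_eq_left hx]
  have h2 := Measure.eqOn_open_of_ae_eq h1 hU hf (hf.inf continuousOn_const)
  intro x hx
  rw [h2 hx]
  exact min_le_right _ _

theorem norm_clm_le_of_partials (D : Plane →L[ℝ] ℝ) {M : ℝ}
    (h : ∀ i, |D (EuclideanSpace.single i 1)| ≤ M) : ‖D‖ ≤ 2 * M := by
  have hM : 0 ≤ M := (abs_nonneg _).trans (h 0)
  refine D.opNorm_le_bound (by positivity) fun v => ?_
  have hv : v = v 0 • EuclideanSpace.single 0 1 + v 1 • EuclideanSpace.single 1 1 := by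
    ext i
    fin_cases i <;> simp
  have hc : ∀ i, |v i| ≤ ‖v‖ := fun i => by simpa using PiLp.norm_apply_le v i
  have key : D v = v 0 * D (EuclideanSpace.single 0 1) + v 1 * D (EuclideanSpace.single 1 1) := by
    conv_lhs => rw [hv]
    simp
  rw [key, Real.norm_eq_abs]
  calc |v 0 * D (EuclideanSpace.single 0 1) + v 1 * D (EuclideanSpace.single 1 1)|
      ≤ |v 0| * |D (EuclideanSpace.single 0 1)| + |v 1| * |D (EuclideanSpace.single 1 1)| := by
        rw [← abs_mul, ← abs_mul]
        exact abs_add_le _ _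
    _ ≤ ‖v‖ * M + ‖v‖ * M := by
        gcongr
        exacts [hc 0, h 0, hc 1, h 1]
    _ = 2 * M * ‖v‖ := by ring

/-- Mollification does not increase the bound on a weak partial derivative. -/
theorem abs_convolution_fderiv_le {U : Set Plane} {F f g : Plane → ℝ} {M : ℝ}
    {i : Fin 2} (hFf : F =ᵐ[volume.restrict U] f) (hg : HasWeakPartial U f i g)
    (hgM : ∀ᵐ x ∂volume.restrict U, |g x| ≤ M) (b : ContDiffBump (0 : Plane)) {x : Plane}
    (hx : Metric.closedBall x b.rOut ⊆ U) (hF0 : ∀ y, y ∉ U → F y = 0) :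
    |convolution F (fun a => fderiv ℝ (b.normed volume) a (EuclideanSpace.single i 1))
      (ContinuousLinearMap.lsmul ℝ ℝ) volume x| ≤ M := by
  set ρ : Plane → ℝ := b.normed volume with hρ
  have hρs : ContDiff ℝ ∞ ρ := b.contDiff_normed
  -- The reflected and translated bump is an admissible test function, since the ball around `x`
  -- lies in `U`.
  set φ : Plane → ℝ := fun t => ρ (x - t) with hφ
  have hφs : ContDiff ℝ ∞ φ := hρs.comp (contDiff_const.sub contDiff_id)
  have hsupp : tsupport φ ⊆ Metric.closedBall x b.rOut := by
    refine closure_minimal (fun t ht => ?_) Metric.isClosed_closedBall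
    have : x - t ∈ Function.support ρ := ht
    rw [hρ, b.support_normed_eq] at this
    rw [mem_ball_zero_iff] at this
    rw [Metric.mem_closedBall, dist_comm, dist_eq_norm]
    exact this.le
  have hcs : HasCompactSupport φ :=
    (isCompact_closedBall x b.rOut).of_isClosed_subset (isClosed_tsupport _) hsupp
  have htest : IsTestFunction U φ := ⟨hφs, hcs, hsupp.trans hx⟩
  have hder : ∀ t v, fderiv ℝ φ t v = -fderiv ℝ ρ (x - t) v := by
    intro t v
    have h1 : HasFDerivAt (fun t : Plane => x - t) (-ContinuousLinearMap.id ℝ Plane) t :=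
      (hasFDerivAt_id t).const_sub x
    have h2 : HasFDerivAt ρ (fderiv ℝ ρ (x - t)) (x - t) :=
      ((hρs.differentiable (by simp)) _).hasFDerivAt
    have h3 : HasFDerivAt φ _ t := h2.comp t h1
    rw [h3.fderiv]
    simp
  have hint : ∫ t, ρ t = 1 := b.integral_normed
  have hφint : ∫ t, φ t = 1 := by
    rw [hφ, integral_sub_left_eq_self ρ volume x, hint]
  have hφnn : ∀ t, 0 ≤ φ t := fun t => b.nonneg_normed _
  -- The minus sign from the reflection cancels the one from the weak derivative, so the convolution
  -- is an average of `g` against a density of mass one.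
  have hconv : convolution F (fun a => fderiv ℝ ρ a (EuclideanSpace.single i 1))
      (ContinuousLinearMap.lsmul ℝ ℝ) volume x = ∫ t in U, g t * φ t := by
    rw [convolution_def]
    simp only [ContinuousLinearMap.lsmul_apply, smul_eq_mul]
    rw [← setIntegral_eq_integral_of_forall_compl_eq_zero (s := U)
      (fun t ht => by rw [hF0 t ht, zero_mul])]
    have h1 := hg.2.2 φ htest
    rw [← neg_eq_iff_eq_neg] at h1
    rw [← h1, ← integral_neg]
    refine integral_congr_ae ?_
    filter_upwards [hFf] with t ht
    rw [ht, hder]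
    ring
  rw [hconv]
  have hφI : Integrable φ volume := hφs.continuous.integrable_of_hasCompactSupport hcs
  calc |∫ t in U, g t * φ t| ≤ ∫ t in U, M * φ t := by
        rw [← Real.norm_eq_abs]
        refine norm_integral_le_of_norm_le (hφI.integrableOn.const_mul M) ?_
        filter_upwards [hgM] with t ht
        rw [norm_mul, Real.norm_eq_abs, Real.norm_eq_abs, abs_of_nonneg (hφnn t)]
        exact mul_le_mul_of_nonneg_right ht (hφnn t)
    _ = M := by
        rw [integral_const_mul, setIntegral_eq_integral_of_forall_compl_eq_zero, hφint, mul_one]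
        intro t ht
        by_contra h
        exact ht (hx (hsupp (subset_tsupport _ h)))

/-- A continuous representative of a `W^{1,∞}` function on a convex open set is Lipschitz. -/
theorem abs_sub_le_of_hasW1InfBound {U : Set Plane} (hU : IsOpen U) (hUc : Convex ℝ U)
    {f e : Plane → ℝ} {M : ℝ} (he : ContinuousOn e U) (hef : ∀ᵐ x ∂volume.restrict U, e x = f x)
    (hf : HasW1InfBound U f M) {x y : Plane} (hx : x ∈ U) (hy : y ∈ U) :
    |e y - e x| ≤ 2 * M * ‖y - x‖ := by
  obtain ⟨-, hfM, hpart⟩ := hf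
  choose g hg hgM hgw using hpart
  -- Extension by zero makes the convolution available on the whole plane; only its values near the
  -- segment matter.
  set F : Plane → ℝ := U.indicator e with hF
  have hFe : ∀ t ∈ U, F t = e t := fun t ht => indicator_of_mem ht _
  have hF0 : ∀ t, t ∉ U → F t = 0 := fun t ht => indicator_of_notMem ht _
  have heM : ∀ t ∈ U, |e t| ≤ M := le_of_ae_le_of_isOpen hU he.abs (by
    filter_upwards [hef, hfM] with t h1 h2
    rwa [h1])
  have hM : 0 ≤ M := (abs_nonneg _).trans (heM x hx)
  have hFM : ∀ t, ‖F t‖ ≤ M := fun t => by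
    by_cases ht : t ∈ U
    · rw [hFe t ht]; exact heM t ht
    · rw [hF0 t ht]; simpa using hM
  have hFm : AEStronglyMeasurable F volume :=
    (aestronglyMeasurable_indicator_iff hU.measurableSet).2
      (he.aestronglyMeasurable hU.measurableSet)
  have hFl : LocallyIntegrable F volume :=
    (memLp_top_of_bound hFm M (ae_of_all _ hFM)).locallyIntegrable le_top
  have hFf : F =ᵐ[volume.restrict U] f := by
    filter_upwards [hef, ae_restrict_mem hU.measurableSet] with t h1 h2
    rw [hFe t h2, h1]
  have hFc : ContinuousOn F U := he.congr hFe
  have hseg : segment ℝ x y ⊆ U := hUc.segment_subset hx hy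
  have hsegc : IsCompact (segment ℝ x y) := by
    rw [segment_eq_image_lineMap]
    exact isCompact_Icc.image AffineMap.lineMap_continuous
  obtain ⟨δ, hδ, hδU⟩ := hsegc.exists_cthickening_subset_open hU hseg
  refine le_of_forall_pos_le_add fun η hη => ?_
  have hnear : ∀ z ∈ U, ∃ r > 0, ∀ t ∈ Metric.ball z r, dist (F t) (F z) ≤ η / 2 := fun z hz => by
    have hc := (hFc.continuousAt (hU.mem_nhds hz))
    obtain ⟨r, hr, h⟩ := Metric.continuousAt_iff.1 hc (η / 2) (by positivity)
    exact ⟨r, hr, fun t ht => (h ht).le⟩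
  obtain ⟨r₁, hr₁, h₁⟩ := hnear x hx
  obtain ⟨r₂, hr₂, h₂⟩ := hnear y hy
  -- Radius `δ` keeps the mollification inside `U` along the whole segment; `r₁` and `r₂` make it
  -- `η/2`-close to `F` at the two endpoints.
  set R := min δ (min r₁ r₂) with hR
  have hRpos : 0 < R := lt_min hδ (lt_min hr₁ hr₂)
  let b : ContDiffBump (0 : Plane) := ⟨R / 2, R, by positivity, by linarith⟩
  have hbR : b.rOut = R := rfl
  set Φ : Plane → ℝ := convolution F (b.normed volume) (ContinuousLinearMap.lsmul ℝ ℝ) volume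
    with hΦ
  have hflip : Φ = convolution (b.normed volume) F (ContinuousLinearMap.lsmul ℝ ℝ) volume := by
    rw [hΦ, ← convolution_flip]
    congr 1
    ext
    simp
  have a₁ : dist (Φ x) (F x) ≤ η / 2 := by
    rw [hflip]
    refine b.dist_normed_convolution_le hFm fun t ht => h₁ t ?_
    exact Metric.ball_subset_ball ((min_le_right _ _).trans (min_le_left _ _)) ht
  have a₂ : dist (Φ y) (F y) ≤ η / 2 := by
    rw [hflip]
    refine b.dist_normed_convolution_le hFm fun t ht => h₂ t ?_
    exact Metric.ball_subset_ball ((min_le_right _ _).trans (min_le_right _ _)) ht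
  have hbc : HasCompactSupport (b.normed volume) := b.hasCompactSupport_normed
  have hbs : ContDiff ℝ 1 (b.normed volume : Plane → ℝ) := b.contDiff_normed
  have hder : ∀ z, HasFDerivAt Φ (convolution F (fderiv ℝ (b.normed volume))
      ((ContinuousLinearMap.lsmul ℝ ℝ).precompR Plane) volume z) z := fun z =>
    hbc.hasFDerivAt_convolution_right _ hFl hbs z
  -- Mean value inequality for the mollification along the segment; the bound does not depend on
  -- `η`, so `η` can tend to zero.
  have hbd := (convex_segment x y).norm_image_sub_le_of_norm_hasFDerivWithin_le
    (C := 2 * M) (fun z _ => (hder z).hasFDerivWithinAt) (fun z hz => by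
      refine norm_clm_le_of_partials _ fun i => ?_
      rw [convolution_precompR_apply _ hFl (hbc.fderiv ℝ) (hbs.continuous_fderiv (by simp))]
      refine abs_convolution_fderiv_le hFf (hgw i) (hgM i) b ?_ hF0
      refine (Metric.closedBall_subset_cthickening hz _).trans ?_
      exact (Metric.cthickening_mono (min_le_left _ _) _).trans hδU)
    (left_mem_segment ℝ x y) (right_mem_segment ℝ x y)
  rw [hFe x hx, Real.dist_eq] at a₁
  rw [hFe y hy, Real.dist_eq] at a₂
  rw [Real.norm_eq_abs] at hbd
  have := abs_le.1 a₁
  have := abs_le.1 a₂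
  have := abs_le.1 hbd
  exact abs_le.2 ⟨by linarith, by linarith⟩

/-! ### Affine functions on a triangle -/

/-- The constant gradient of an affine function. -/
def affGrad (ℓ : Plane →ᵃ[ℝ] ℝ) : Plane :=
  (InnerProductSpace.toDual ℝ Plane).symm (LinearMap.toContinuousLinearMap ℓ.linear)

theorem inner_affGrad (ℓ : Plane →ᵃ[ℝ] ℝ) (w : Plane) : ⟪affGrad ℓ, w⟫ = ℓ.linear w := by
  simp [affGrad]

theorem affine_sub_eq (ℓ : Plane →ᵃ[ℝ] ℝ) (x y : Plane) : ℓ x - ℓ y = ⟪affGrad ℓ, x - y⟫ := by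
  rw [inner_affGrad, ← vsub_eq_sub x y, ℓ.linearMap_vsub, vsub_eq_sub]

theorem hasGradientAt_affine (ℓ : Plane →ᵃ[ℝ] ℝ) (x : Plane) :
    HasGradientAt ℓ (affGrad ℓ) x := by
  rw [hasGradientAt_iff_hasFDerivAt, affGrad, LinearIsometryEquiv.apply_symm_apply]
  exact (⟨ℓ, ℓ.continuous_of_finiteDimensional⟩ : Plane →ᴬ[ℝ] ℝ).hasFDerivAt

namespace Triangle

variable (T : Triangle)

theorem convex_carrier : Convex ℝ T.carrier := convex_convexHull ℝ _

theorem isCompact_carrier : IsCompact T.carrier := (finite_range T).isCompact_convexHull ℝ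

theorem isClosed_carrier : IsClosed T.carrier := T.isCompact_carrier.isClosed

theorem measurableSet_carrier : MeasurableSet T.carrier := T.isClosed_carrier.measurableSet

theorem vertex_mem (i : Fin 3) : T i ∈ T.carrier := subset_convexHull ℝ _ (mem_range_self i)

theorem interior_nonempty : (interior T.carrier).Nonempty := by
  rw [carrier, interior_convexHull_nonempty_iff_affineSpan_eq_top]
  exact T.tot

theorem closure_interior : closure (interior T.carrier) = T.carrier := by
  rw [T.convex_carrier.closure_interior_eq_closure_of_nonempty_interior T.interior_nonempty,
    T.isClosed_carrier.closure_eq]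

theorem interior_ae_eq : (interior T.carrier : Set Plane) =ᵐ[volume] T.carrier :=
  interior_ae_eq_of_null_frontier (T.convex_carrier.addHaar_frontier volume)

theorem volume_lt_top : volume T.carrier < ⊤ := T.isCompact_carrier.measure_lt_top

/-- The area of the triangle. -/
def area : ℝ := volume.real T.carrier

theorem area_pos : 0 < T.area := by
  refine ENNReal.toReal_pos (ne_of_gt ?_) T.volume_lt_top.ne
  exact (isOpen_interior.measure_pos volume T.interior_nonempty).trans_le
    (measure_mono interior_subset)

theorem dist_le_diam {x y : Plane} (hx : x ∈ T.carrier) (hy : y ∈ T.carrier) :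
    ‖x - y‖ ≤ Metric.diam T.carrier := by
  rw [← dist_eq_norm]
  exact Metric.dist_le_diam_of_mem T.isCompact_carrier.isBounded hx hy

/-- The gradient of a barycentric coordinate. -/
abbrev coordGrad (i : Fin 3) : Plane := affGrad (T.coord i)

theorem edgeWeight_eq (i j : Fin 3) :
    edgeWeight T i j = -(T.area * ⟪T.coordGrad i, T.coordGrad j⟫) := by
  have h : ∀ (i : Fin 3) (x : Plane), gradient (fun w => T.coord i w) x = T.coordGrad i :=
    fun i x => (hasGradientAt_affine (T.coord i) x).gradient
  simp only [edgeWeight, h, setIntegral_const, smul_eq_mul, area]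

theorem affine_apply_eq (ℓ : Plane →ᵃ[ℝ] ℝ) (x : Plane) :
    ℓ x = ∑ i, T.coord i x * ℓ (T i) := by
  have h := T.affineCombination_coord_eq_self x
  conv_lhs => rw [← h]
  rw [Finset.map_affineCombination _ _ _ (T.sum_coord_apply_eq_one x),
    Finset.affineCombination_eq_linear_combination _ _ _ (T.sum_coord_apply_eq_one x)]
  simp

theorem affGrad_eq_sum (ℓ : Plane →ᵃ[ℝ] ℝ) :
    affGrad ℓ = ∑ i, ℓ (T i) • T.coordGrad i := by
  refine ext_inner_right ℝ fun w => ?_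
  have h1 := affine_sub_eq ℓ w 0
  rw [sub_zero] at h1
  rw [← h1, T.affine_apply_eq ℓ w, T.affine_apply_eq ℓ 0, sum_inner, ← Finset.sum_sub_distrib]
  refine Finset.sum_congr rfl fun i _ => ?_
  rw [real_inner_smul_left, coordGrad]
  have h2 := affine_sub_eq (T.coord i) w 0
  rw [sub_zero] at h2
  rw [← h2]
  ring

theorem sum_coordGrad : ∑ i, T.coordGrad i = 0 := by
  have h := T.affGrad_eq_sum (AffineMap.const ℝ Plane (1 : ℝ))
  have h0 : affGrad (AffineMap.const ℝ Plane (1 : ℝ)) = 0 := by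
    simp [affGrad]
  rw [h0] at h
  simpa using h.symm

/-- The Dirichlet energy of an affine function in terms of the edge differences. -/
theorem sum_edgeWeight_mul_sq (ℓ : Plane →ᵃ[ℝ] ℝ) :
    ∑ i, edgeWeight T i (i + 1) * (ℓ (T (i + 1)) - ℓ (T i)) ^ 2 =
      T.area * ‖affGrad ℓ‖ ^ 2 := by
  have h0 := T.sum_coordGrad
  rw [Fin.sum_univ_three] at h0
  -- Eliminating the third gradient leaves a polynomial identity in the inner products of the first
  -- two.
  have e2 : T.coordGrad 2 = -(T.coordGrad 0) - T.coordGrad 1 := by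
    rw [sub_eq_add_neg, ← sub_eq_zero, ← h0]; abel
  rw [← real_inner_self_eq_norm_sq, T.affGrad_eq_sum ℓ, Fin.sum_univ_three, Fin.sum_univ_three]
  simp only [edgeWeight_eq]
  have i1 : (0 : Fin 3) + 1 = 1 := rfl
  have i2 : (1 : Fin 3) + 1 = 2 := rfl
  have i3 : (2 : Fin 3) + 1 = 0 := rfl
  rw [i1, i2, i3, e2]
  simp only [inner_add_left, inner_add_right, inner_sub_left, inner_sub_right, inner_neg_left,
    inner_neg_right, real_inner_smul_left, real_inner_smul_right, real_inner_comm (T.coordGrad 0) (T.coordGrad 1)]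
  ring

theorem coord_mem_Icc {x : Plane} (hx : x ∈ T.carrier) (i : Fin 3) :
    T.coord i x ∈ Icc (0 : ℝ) 1 := by
  have h0 : ∀ j, 0 ≤ T.coord j x := by
    rw [carrier, T.convexHull_eq_nonneg_coord] at hx
    exact hx
  refine ⟨h0 i, ?_⟩
  rw [← T.sum_coord_apply_eq_one x]
  exact Finset.single_le_sum (fun j _ => h0 j) (Finset.mem_univ i)

/-- The gradient of a barycentric coordinate is bounded by the inverse inradius. -/
theorem norm_coordGrad_le {c : Plane} {r : ℝ} (hr : 0 < r) (hc : Metric.ball c r ⊆ T.carrier)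
    (i : Fin 3) : ‖T.coordGrad i‖ ≤ 1 / r := by
  set g := T.coordGrad i with hg
  rcases eq_or_ne g 0 with h | h
  · rw [h, norm_zero]; positivity
  have hgp : 0 < ‖g‖ := norm_pos_iff.2 h
  -- Between `c - w` and `c + w`, both in the ball, the coordinate grows by `r‖g‖`, while its values
  -- stay in `[0,1]`.
  set w : Plane := (r / 2 / ‖g‖) • g with hw
  have hwn : ‖w‖ = r / 2 := by
    rw [hw, norm_smul, Real.norm_eq_abs, abs_of_pos (by positivity)]
    field_simp
  have m1 : c + w ∈ T.carrier := hc (by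
    rw [Metric.mem_ball, dist_eq_norm, add_sub_cancel_left, hwn]; linarith)
  have m2 : c - w ∈ T.carrier := hc (by
    rw [Metric.mem_ball, dist_eq_norm, sub_sub_cancel_left, norm_neg, hwn]; linarith)
  have k1 := (T.coord_mem_Icc m1 i).2
  have k2 := (T.coord_mem_Icc m2 i).1
  have k3 := affine_sub_eq (T.coord i) (c + w) (c - w)
  have k4 : c + w - (c - w) = (2 : ℝ) • w := by rw [two_smul]; abel
  rw [k4, hw, real_inner_smul_right, real_inner_smul_right] at k3
  change _ = 2 * (r / 2 / ‖g‖ * ⟪g, g⟫) at k3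
  rw [real_inner_self_eq_norm_sq] at k3
  have k5 : 2 * (r / 2 / ‖g‖ * ‖g‖ ^ 2) = r * ‖g‖ := by field_simp
  rw [k5] at k3
  rw [le_div_iff₀ hr]
  linarith

theorem abs_edgeWeight_le {c : Plane} {r : ℝ} (hr : 0 < r) (hc : Metric.ball c r ⊆ T.carrier)
    (i j : Fin 3) : |edgeWeight T i j| ≤ T.area / r ^ 2 := by
  rw [edgeWeight_eq, abs_neg, abs_mul, abs_of_pos T.area_pos]
  have h1 := abs_real_inner_le_norm (T.coordGrad i) (T.coordGrad j)
  have h2 : ‖T.coordGrad i‖ * ‖T.coordGrad j‖ ≤ 1 / r * (1 / r) := by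
    gcongr
    exacts [T.norm_coordGrad_le hr hc i, T.norm_coordGrad_le hr hc j]
  calc T.area * |⟪T.coordGrad i, T.coordGrad j⟫| ≤ T.area * (1 / r * (1 / r)) :=
        mul_le_mul_of_nonneg_left (h1.trans h2) T.area_pos.le
    _ = T.area / r ^ 2 := by field_simp

theorem abs_affine_sub_le (ℓ : Plane →ᵃ[ℝ] ℝ) {x y : Plane} (hx : x ∈ T.carrier)
    (hy : y ∈ T.carrier) : |ℓ x - ℓ y| ≤ Metric.diam T.carrier * ‖affGrad ℓ‖ := by
  rw [affine_sub_eq, mul_comm]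
  exact (abs_real_inner_le_norm _ _).trans
    (mul_le_mul_of_nonneg_left (T.dist_le_diam hx hy) (norm_nonneg _))

/-- Point values of an affine function are controlled by its `L²` norm and its gradient. -/
theorem area_mul_sq_le (ℓ : Plane →ᵃ[ℝ] ℝ) {x : Plane} (hx : x ∈ T.carrier) :
    T.area * ℓ x ^ 2 ≤ 2 * (∫ y in T.carrier, ℓ y ^ 2) +
      2 * Metric.diam T.carrier ^ 2 * (T.area * ‖affGrad ℓ‖ ^ 2) := by
  have hint : IntegrableOn (fun y => ℓ y ^ 2) T.carrier :=
    (ℓ.continuous_of_finiteDimensional.pow 2).continuousOn.integrableOn_compact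
      T.isCompact_carrier
  have hconst : ∀ c : ℝ, IntegrableOn (fun _ : Plane => c) T.carrier := fun c =>
    integrableOn_const T.volume_lt_top.ne
  have key : ∫ _ in T.carrier, ℓ x ^ 2 ≤ ∫ y in T.carrier,
      (2 * ℓ y ^ 2 + 2 * (Metric.diam T.carrier * ‖affGrad ℓ‖) ^ 2) := by
    refine setIntegral_mono_on (hconst _) ((hint.const_mul 2).add (hconst _))
      T.measurableSet_carrier fun y hy => ?_
    have h := T.abs_affine_sub_le ℓ hx hy
    have h' : (ℓ x - ℓ y) ^ 2 ≤ (Metric.diam T.carrier * ‖affGrad ℓ‖) ^ 2 :=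
      sq_le_sq' (by linarith [neg_abs_le (ℓ x - ℓ y)]) ((le_abs_self _).trans h)
    -- This is `a² ≤ 2b² + 2(a - b)²`, whose slack is `(a - 2b)²`.
    nlinarith [sq_nonneg (ℓ x - 2 * ℓ y)]
  rw [integral_add (hint.const_mul 2) (hconst _), integral_const_mul, setIntegral_const,
    setIntegral_const, smul_eq_mul, smul_eq_mul] at key
  calc T.area * ℓ x ^ 2 ≤ _ := key
    _ = _ := by rw [area]; ring

end Triangle

/-! ### Edge potentials and harmonic averages -/

theorem inv_integral_inv_mem_Icc {κ : ℝ → ℝ} {a b : ℝ} (hκ : ContinuousOn κ (Icc 0 1)) (ha : 0 < a)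
    (h : ∀ t ∈ Icc (0 : ℝ) 1, κ t ∈ Icc a b) :
    (∫ t in (0 : ℝ)..1, (κ t)⁻¹)⁻¹ ∈ Icc a b := by
  have hpos : ∀ t ∈ Icc (0 : ℝ) 1, 0 < κ t := fun t ht => ha.trans_le (h t ht).1
  have hb : 0 < b := (hpos 0 (by simp)).trans_le (h 0 (by simp)).2
  have hI : IntervalIntegrable (fun t => (κ t)⁻¹) volume 0 1 := by
    refine ContinuousOn.intervalIntegrable ?_
    rw [uIcc_of_le zero_le_one]
    exact hκ.inv₀ fun t ht => (hpos t ht).ne'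
  have h1 : ∫ t in (0 : ℝ)..1, (κ t)⁻¹ ≤ a⁻¹ := by
    have := intervalIntegral.integral_mono_on zero_le_one hI
      (intervalIntegrable_const (c := a⁻¹)) fun t ht => inv_anti₀ ha (h t ht).1
    simpa using this
  have h2 : b⁻¹ ≤ ∫ t in (0 : ℝ)..1, (κ t)⁻¹ := by
    have := intervalIntegral.integral_mono_on zero_le_one
      (intervalIntegrable_const (c := b⁻¹)) hI fun t ht => inv_anti₀ (hpos t ht) (h t ht).2
    simpa using this
  have h3 : 0 < ∫ t in (0 : ℝ)..1, (κ t)⁻¹ := (inv_pos.2 hb).trans_le h2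
  exact ⟨by rw [le_inv_comm₀ ha h3]; exact h1, by rw [inv_le_comm₀ h3 hb]; exact h2⟩

section Edge

variable {e : Plane → ℝ} {ζ : Plane → Plane} {x₀ x₁ : Plane} {ε₀ Z h : ℝ}

theorem abs_edgePotential_le (hε₀ : 0 < ε₀) (hZ : 0 ≤ Z)
    (he : ∀ t ∈ Icc (0 : ℝ) 1, ε₀ ≤ e (AffineMap.lineMap x₀ x₁ t))
    (hζ : ∀ t ∈ Icc (0 : ℝ) 1, ‖ζ (AffineMap.lineMap x₀ x₁ t)‖ ≤ Z) (hx : ‖x₁ - x₀‖ ≤ h)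
    {t : ℝ} (ht : t ∈ Icc (0 : ℝ) 1) : |edgePotential e ζ x₀ x₁ t| ≤ Z * h / ε₀ := by
  have hh : 0 ≤ h := (norm_nonneg _).trans hx
  have h1 := intervalIntegral.norm_integral_le_of_norm_le_const (a := (0 : ℝ)) (b := t)
    (C := Z * h / ε₀) (f := fun s => (e (AffineMap.lineMap x₀ x₁ s))⁻¹ *
      ⟪ζ (AffineMap.lineMap x₀ x₁ s), x₁ - x₀⟫) (fun s hs => by
      rw [uIoc_of_le ht.1] at hs
      have hs' : s ∈ Icc (0 : ℝ) 1 := ⟨hs.1.le, hs.2.trans ht.2⟩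
      have hp := hε₀.trans_le (he s hs')
      rw [norm_mul, norm_inv, Real.norm_eq_abs, abs_of_pos hp, inv_mul_eq_div]
      refine div_le_div₀ (by positivity) ?_ hε₀ (he s hs')
      exact (abs_real_inner_le_norm _ _).trans
        (mul_le_mul (hζ s hs') hx (norm_nonneg _) hZ))
  refine h1.trans ?_
  rw [sub_zero, abs_of_nonneg ht.1]
  exact mul_le_of_le_one_right (by positivity) ht.2

theorem edgePotential_zero : edgePotential e ζ x₀ x₁ 0 = 0 := by
  simp [edgePotential]

theorem continuousOn_edgeKappa (hε₀ : 0 < ε₀)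
    (hec : ContinuousOn (fun t : ℝ => e (AffineMap.lineMap x₀ x₁ t)) (Icc 0 1))
    (hζc : ContinuousOn (fun t : ℝ => ζ (AffineMap.lineMap x₀ x₁ t)) (Icc 0 1))
    (he : ∀ t ∈ Icc (0 : ℝ) 1, ε₀ ≤ e (AffineMap.lineMap x₀ x₁ t)) :
    ContinuousOn (edgeKappa e ζ x₀ x₁) (Icc 0 1) := by
  refine hec.mul (Real.continuous_exp.comp_continuousOn ?_)
  refine ContinuousOn.neg ?_
  have hβ : ContinuousOn (fun s : ℝ => (e (AffineMap.lineMap x₀ x₁ s))⁻¹ *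
      ⟪ζ (AffineMap.lineMap x₀ x₁ s), x₁ - x₀⟫) (Icc 0 1) :=
    (hec.inv₀ fun t ht => (hε₀.trans_le (he t ht)).ne').mul
      (hζc.inner continuousOn_const)
  have := intervalIntegral.continuousOn_primitive_interval (μ := volume) (a := (0 : ℝ)) (b := 1)
    (by rw [uIcc_of_le zero_le_one]; exact hβ.integrableOn_compact isCompact_Icc)
  rwa [uIcc_of_le zero_le_one] at this

/-- With `θ = Zh/ε₀ ≤ 1` bounding `|ψ|`, the coefficient `κ` stays between `(m - 2Mh)(1 - θ)` and
`(m + 2Mh)(1 + 2θ)`, and so does its harmonic mean. The `6` comes from expanding the upper bound;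
the `18` from `H ≤ 9M` and `|e^ψ - 1| ≤ 2θ`. The reference value `m` need not be attained on the
edge, so that all edges of a triangle can share it. -/
theorem edge_bounds {m M : ℝ} (hε₀ : 0 < ε₀) (hZ : 0 ≤ Z) (hM : 0 ≤ M)
    (hec : ContinuousOn (fun t : ℝ => e (AffineMap.lineMap x₀ x₁ t)) (Icc 0 1))
    (hζc : ContinuousOn (fun t : ℝ => ζ (AffineMap.lineMap x₀ x₁ t)) (Icc 0 1))
    (he : ∀ t ∈ Icc (0 : ℝ) 1, ε₀ ≤ e (AffineMap.lineMap x₀ x₁ t))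
    (hm : ∀ t ∈ Icc (0 : ℝ) 1, |e (AffineMap.lineMap x₀ x₁ t) - m| ≤ 2 * M * h)
    (hm0 : 0 ≤ m) (hmM : m ≤ M)
    (hζ : ∀ t ∈ Icc (0 : ℝ) 1, ‖ζ (AffineMap.lineMap x₀ x₁ t)‖ ≤ Z) (hx : ‖x₁ - x₀‖ ≤ h)
    (hh1 : h ≤ 1) (hθ : Z * h / ε₀ ≤ 1) :
    |harmonicAverage e ζ x₀ x₁ - m| ≤ (6 * M + 18 * M * Z / ε₀) * h ∧
    |harmonicAverage e ζ x₀ x₁ * (Real.exp (edgePotential e ζ x₀ x₁ 1) - 1)| ≤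
      (6 * M + 18 * M * Z / ε₀) * h := by
  have hh : 0 ≤ h := (norm_nonneg _).trans hx
  set θ := Z * h / ε₀ with hθd
  have hθ0 : 0 ≤ θ := by positivity
  have hψ : ∀ t ∈ Icc (0 : ℝ) 1, |edgePotential e ζ x₀ x₁ t| ≤ θ := fun t ht =>
    abs_edgePotential_le hε₀ hZ he hζ hx ht
  have hexp : ∀ s : ℝ, |s| ≤ θ → |Real.exp s - 1| ≤ 2 * θ := fun s hs =>
    (Real.abs_exp_sub_one_le (hs.trans hθ)).trans (by linarith)
  have hlow : ∀ s : ℝ, |s| ≤ θ → 1 - θ ≤ Real.exp s := fun s hs => by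
    linarith [Real.add_one_le_exp s, (abs_le.1 hs).1]
  -- The maximum with `ε₀` keeps the lower bound positive when `m - 2Mh` is not.
  set a := max ε₀ (m - 2 * M * h) with had
  have ha : 0 < a := hε₀.trans_le (le_max_left _ _)
  have hea : ∀ t ∈ Icc (0 : ℝ) 1, a ≤ e (AffineMap.lineMap x₀ x₁ t) := fun t ht =>
    max_le (he t ht) (by linarith [(abs_le.1 (hm t ht)).1])
  have haM : a ≤ m + 2 * M * h := by
    have h0 := hea 0 (by simp)
    have h1 := (abs_le.1 (hm 0 (by simp))).2
    linarith
  have hH := inv_integral_inv_mem_Icc (a := a * Real.exp (-θ)) (b := (m + 2 * M * h) * (1 + 2 * θ))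
    (continuousOn_edgeKappa hε₀ hec hζc he) (by positivity) (fun t ht => by
      have hs := hψ t ht
      have hs' : |-edgePotential e ζ x₀ x₁ t| ≤ θ := by rwa [abs_neg]
      refine ⟨?_, ?_⟩
      · refine mul_le_mul (hea t ht) ?_ (Real.exp_pos _).le (ha.trans_le (hea t ht)).le
        exact Real.exp_le_exp.2 (by linarith [(abs_le.1 hs).2])
      · refine mul_le_mul ?_ ?_ (Real.exp_pos _).le (by positivity)
        · linarith [(abs_le.1 (hm t ht)).2]
        · linarith [(abs_le.1 (hexp _ hs')).2])
  change harmonicAverage e ζ x₀ x₁ ∈ _ at hH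
  set H := harmonicAverage e ζ x₀ x₁
  have hH0 : 0 ≤ H := by
    refine le_trans ?_ hH.1
    positivity
  have hMθ : M * Z / ε₀ * h = M * θ := by rw [hθd]; ring
  have hMθ0 : 0 ≤ M * θ := by positivity
  have hMh : 0 ≤ M * h := by positivity
  have hmθ : m * θ ≤ M * θ := mul_le_mul_of_nonneg_right hmM hθ0
  have hMhθ : M * h * θ ≤ M * h := mul_le_of_le_one_right hMh hθ
  have hL : (6 * M + 18 * M * Z / ε₀) * h = 6 * (M * h) + 18 * (M * θ) := by
    rw [← hMθ]; ring
  have hup : H ≤ m + 2 * (M * θ) + 6 * (M * h) := by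
    refine hH.2.trans ?_
    nlinarith
  rw [hL]
  constructor
  · rw [abs_le]
    constructor
    · have h1 : a * (1 - θ) ≤ H := by
        refine le_trans (mul_le_mul_of_nonneg_left ?_ ha.le) hH.1
        exact hlow _ (by rw [abs_neg, abs_of_nonneg hθ0])
      have h2 : (m - 2 * M * h) * (1 - θ) ≤ a * (1 - θ) :=
        mul_le_mul_of_nonneg_right (le_max_right _ _) (by linarith)
      nlinarith
    · linarith
  · rw [abs_mul, abs_of_nonneg hH0]
    have h1 := hexp _ (hψ 1 (by simp))
    have h2 : H ≤ 9 * M := by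
      have : M * θ ≤ M := mul_le_of_le_one_right hM hθ
      have : M * h ≤ M := mul_le_of_le_one_right hM hh1
      linarith
    calc H * |Real.exp (edgePotential e ζ x₀ x₁ 1) - 1| ≤ 9 * M * (2 * θ) :=
          mul_le_mul h2 h1 (abs_nonneg _) (by positivity)
      _ ≤ _ := by linarith

end Edge

/-! ### Gårding's inequality on one triangle -/

/-- Gårding's inequality for one element, in terms of abstract edge data. -/
theorem sum_edge_lower_bound {ι : Type*} (s : Finset ι) (w H b δ y : ι → ℝ)
    {m A r h L G σ μ η : ℝ} (hA : 0 ≤ A) (hr : 0 < r) (hh : 0 ≤ h) (hL : 0 ≤ L) (hG : 0 ≤ G)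
    (hη : 0 < η) (hhr : h ≤ σ * r)
    (hw : ∀ i ∈ s, |w i| ≤ A / r ^ 2) (hH : ∀ i ∈ s, |H i - m| ≤ L * h)
    (hb : ∀ i ∈ s, |H i * b i| ≤ L * h) (hδ : ∀ i ∈ s, |δ i| ≤ h * G)
    (hy : ∀ i ∈ s, A * y i ^ 2 ≤ 2 * μ + 2 * h ^ 2 * (A * G ^ 2)) :
    m * ∑ i ∈ s, w i * δ i ^ 2 - s.card * (σ ^ 2 * L * (h * (A * G ^ 2) + η * (A * G ^ 2) +
        (μ + h ^ 2 * (A * G ^ 2)) / (2 * η))) ≤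
      ∑ i ∈ s, w i * H i * (δ i + b i * y i) * δ i := by
  rw [Finset.mul_sum, ← nsmul_eq_mul, ← Finset.sum_const, ← Finset.sum_sub_distrib]
  refine Finset.sum_le_sum fun i hi => ?_
  have hσ : h ^ 2 / r ^ 2 ≤ σ ^ 2 := by
    rw [← div_pow]
    exact pow_le_pow_left₀ (by positivity) ((div_le_iff₀ hr).2 hhr) 2
  have hw' : 0 ≤ A / r ^ 2 := by positivity
  -- Error of replacing `H` by `m`. The two powers of `h` in `δ²` absorb the `r⁻²` of the weight,
  -- and the `h` from `H - m` remains.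
  have t1 : |w i * (H i - m) * δ i ^ 2| ≤ σ ^ 2 * L * (h * (A * G ^ 2)) := by
    rw [abs_mul, abs_mul, abs_pow]
    calc |w i| * |H i - m| * |δ i| ^ 2 ≤ A / r ^ 2 * (L * h) * (h * G) ^ 2 := by
          gcongr
          exacts [hw i hi, hH i hi, hδ i hi]
      _ = h ^ 2 / r ^ 2 * (L * (h * (A * G ^ 2))) := by ring
      _ ≤ σ ^ 2 * (L * (h * (A * G ^ 2))) := by gcongr
      _ = _ := by ring
  -- Here `H b` and `δ` give one power of `h` each, both used up against `r⁻²`. No smallness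
  -- remains, so Young's inequality with parameter `η` is needed.
  have t2 : |w i * (H i * b i) * y i * δ i| ≤
      σ ^ 2 * L * (η * (A * G ^ 2) + (μ + h ^ 2 * (A * G ^ 2)) / (2 * η)) := by
    rw [abs_mul, abs_mul, abs_mul]
    calc |w i| * |H i * b i| * |y i| * |δ i| ≤ A / r ^ 2 * (L * h) * |y i| * (h * G) := by
          gcongr
          exacts [hw i hi, hb i hi, hδ i hi]
      _ = h ^ 2 / r ^ 2 * (L * (A * |y i| * G)) := by ring
      _ ≤ σ ^ 2 * (L * (A * |y i| * G)) := by gcongr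
      _ ≤ σ ^ 2 * (L * (η * (A * G ^ 2) + (μ + h ^ 2 * (A * G ^ 2)) / (2 * η))) := by
          gcongr
          have h1 : |y i| * G ≤ η * G ^ 2 + y i ^ 2 / (4 * η) := by
            have : η * G ^ 2 + y i ^ 2 / (4 * η) - |y i| * G =
                (2 * η * G - |y i|) ^ 2 / (4 * η) := by
              rw [← sq_abs (y i)]
              field_simp
              ring
            have : 0 ≤ (2 * η * G - |y i|) ^ 2 / (4 * η) := by positivity
            linarith
          calc A * |y i| * G = A * (|y i| * G) := by ring
            _ ≤ A * (η * G ^ 2 + y i ^ 2 / (4 * η)) := by gcongr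
            _ = η * (A * G ^ 2) + A * y i ^ 2 / (4 * η) := by ring
            _ ≤ η * (A * G ^ 2) + (2 * μ + 2 * h ^ 2 * (A * G ^ 2)) / (4 * η) := by
                gcongr
                exact hy i hi
            _ = _ := by
                field_simp
                ring
      _ = _ := by ring
  have e1 : w i * H i * (δ i + b i * y i) * δ i = m * (w i * δ i ^ 2) +
      w i * (H i - m) * δ i ^ 2 + w i * (H i * b i) * y i * δ i := by ring
  rw [e1]
  have := (abs_le.1 t1).1
  have := (abs_le.1 t2).1
  linarith

theorem Triangle.lineMap_mem (T : Triangle) {x y : Plane} (hx : x ∈ T.carrier) (hy : y ∈ T.carrier)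
    {t : ℝ} (ht : t ∈ Icc (0 : ℝ) 1) : AffineMap.lineMap x y t ∈ T.carrier :=
  T.convex_carrier.lineMap_mem hx hy ht

theorem Triangle.gradient_eq_of_eqOn (T : Triangle) {v : Plane → ℝ} {ℓ : Plane →ᵃ[ℝ] ℝ}
    (hv : EqOn v ℓ T.carrier) {x : Plane} (hx : x ∈ interior T.carrier) :
    HasGradientAt v (affGrad ℓ) x := by
  refine (hasGradientAt_affine ℓ x).congr_of_eventuallyEq ?_
  filter_upwards [mem_interior_iff_mem_nhds.1 hx] with y hy using hv hy

theorem Triangle.ae_gradient_eq (T : Triangle) {v : Plane → ℝ} {ℓ : Plane →ᵃ[ℝ] ℝ}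
    (hv : EqOn v ℓ T.carrier) :
    ∀ᵐ x ∂volume.restrict T.carrier, HasGradientAt v (affGrad ℓ) x := by
  rw [← Measure.restrict_congr_set T.interior_ae_eq]
  filter_upwards [ae_restrict_mem isOpen_interior.measurableSet] with x hx
  exact T.gradient_eq_of_eqOn hv hx

theorem Triangle.integrableOn_gradient_sq (T : Triangle) {v : Plane → ℝ} {ℓ : Plane →ᵃ[ℝ] ℝ}
    (hv : EqOn v ℓ T.carrier) : IntegrableOn (fun x => ‖gradient v x‖ ^ 2) T.carrier := by
  refine (integrableOn_const (C := ‖affGrad ℓ‖ ^ 2) T.volume_lt_top.ne).congr ?_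
  filter_upwards [T.ae_gradient_eq hv] with x hx
  rw [hx.gradient]

theorem Triangle.integral_gradient_sq (T : Triangle) {v : Plane → ℝ} {ℓ : Plane →ᵃ[ℝ] ℝ}
    (hv : EqOn v ℓ T.carrier) :
    ∫ x in T.carrier, ‖gradient v x‖ ^ 2 = T.area * ‖affGrad ℓ‖ ^ 2 := by
  have : ∫ x in T.carrier, ‖gradient v x‖ ^ 2 = ∫ _ in T.carrier, ‖affGrad ℓ‖ ^ 2 := by
    refine integral_congr_ae ?_
    filter_upwards [T.ae_gradient_eq hv] with x hx
    rw [hx.gradient]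
  rw [this, setIntegral_const, smul_eq_mul, Triangle.area]

theorem Triangle.area_mul_sq_le' (T : Triangle) {v : Plane → ℝ} {ℓ : Plane →ᵃ[ℝ] ℝ}
    (hv : EqOn v ℓ T.carrier) {x : Plane} (hx : x ∈ T.carrier) :
    T.area * v x ^ 2 ≤ 2 * (∫ y in T.carrier, v y ^ 2) +
      2 * Metric.diam T.carrier ^ 2 * ∫ y in T.carrier, ‖gradient v y‖ ^ 2 := by
  rw [T.integral_gradient_sq hv, hv hx,
    setIntegral_congr_fun T.measurableSet_carrier fun y hy => congrArg (· ^ 2) (hv hy)]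
  exact T.area_mul_sq_le ℓ hx

/-- A threshold on the mesh size and a constant for which Gårding's inequality holds. -/
theorem exists_localForm_lower_bound {ε₀ M Z : ℝ} (σ : ℝ) (hε₀ : 0 < ε₀) (hM : 0 ≤ M)
    (hZ : 0 ≤ Z) :
    ∃ K > 0, ∃ h₀ > 0, ∀ (T : Triangle) (e : Plane → ℝ) (ζ : Plane → Plane) (c : Plane) (r : ℝ),
      0 < r → Metric.ball c r ⊆ T.carrier → Metric.diam T.carrier ≤ σ * r →
      Metric.diam T.carrier ≤ h₀ →
      ContinuousOn e T.carrier → (∀ x ∈ T.carrier, ε₀ ≤ e x) → (∀ x ∈ T.carrier, e x ≤ M) →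
      (∀ x ∈ T.carrier, ∀ y ∈ T.carrier, |e x - e y| ≤ 2 * M * ‖x - y‖) →
      ContinuousOn ζ T.carrier → (∀ x ∈ T.carrier, ‖ζ x‖ ≤ Z) →
      ∀ (v : Plane → ℝ) (ℓ : Plane →ᵃ[ℝ] ℝ), EqOn v ℓ T.carrier →
        ε₀ / 2 * (∫ x in T.carrier, ‖gradient v x‖ ^ 2) - K * (∫ x in T.carrier, v x ^ 2) ≤
          localForm T e ζ v v := by
  set L := 6 * M + 18 * M * Z / ε₀ with hL
  have hL0 : 0 ≤ L := by positivity
  -- The factor three counts the edges.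
  set Q := 3 * (σ ^ 2 * L) with hQ
  have hQ0 : 0 ≤ Q := by positivity
  -- Each of the three gradient errors is to cost at most `ε₀/8`, a total below `ε₀/2`. The `+ 1`
  -- covers `Q = 0`.
  set η := ε₀ / (8 * (Q + 1)) with hη
  have hη0 : 0 < η := by positivity
  have hQη : Q * η ≤ ε₀ / 8 := by
    rw [hη, mul_div_assoc', div_le_div_iff₀ (by positivity) (by norm_num)]
    nlinarith
  -- The bound `h ≤ η` controls the terms `Qh` and `Qh²/(2η)`; `h ≤ ε₀/(Z + 1)` ensures `Zh/ε₀ ≤ 1`.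
  refine ⟨(Q + 1) / (2 * η), by positivity, min 1 (min η (ε₀ / (Z + 1))), by positivity, ?_⟩
  intro T e ζ c r hr hc hσ hh hec he heM heL hζc hζ v ℓ hv
  set h := Metric.diam T.carrier with hhd
  have hh0 : 0 ≤ h := Metric.diam_nonneg
  have hh1 : h ≤ 1 := hh.trans (min_le_left _ _)
  have hhη : h ≤ η := hh.trans ((min_le_right _ _).trans (min_le_left _ _))
  have hhZ : h ≤ ε₀ / (Z + 1) := hh.trans ((min_le_right _ _).trans (min_le_right _ _))
  have hθ : Z * h / ε₀ ≤ 1 := by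
    rw [le_div_iff₀ (by positivity)] at hhZ
    rw [div_le_one hε₀]
    nlinarith
  set S := ∫ x in T.carrier, ‖gradient v x‖ ^ 2 with hS
  set μ := ∫ x in T.carrier, v x ^ 2 with hμ
  have hSA : S = T.area * ‖affGrad ℓ‖ ^ 2 := T.integral_gradient_sq hv
  have hS0 : 0 ≤ S := integral_nonneg fun _ => by positivity
  have hμ0 : 0 ≤ μ := integral_nonneg fun _ => by positivity
  have hmem : ∀ i (t : ℝ), t ∈ Icc (0 : ℝ) 1 →
      AffineMap.lineMap (T i) (T (i + 1)) t ∈ T.carrier := fun i t ht =>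
    T.lineMap_mem (T.vertex_mem i) (T.vertex_mem (i + 1)) ht
  have hlc : ∀ i, ContinuousOn (fun t : ℝ => AffineMap.lineMap (T i) (T (i + 1)) t) (Icc 0 1) :=
    fun i => AffineMap.lineMap_continuous.continuousOn
  -- The same `m = e (T 0)` serves all three edges: weights of either sign sum to the Dirichlet
  -- energy only behind a common factor.
  have hedge : ∀ i, _ ∧ _ := fun i =>
    edge_bounds (e := e) (ζ := ζ) (x₀ := T i) (x₁ := T (i + 1)) (h := h) (m := e (T 0)) hε₀ hZ hM
      (hec.comp (hlc i) (hmem i)) (hζc.comp (hlc i) (hmem i))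
      (fun t ht => he _ (hmem i t ht)) (fun t ht =>
        (heL _ (hmem i t ht) _ (T.vertex_mem 0)).trans (mul_le_mul_of_nonneg_left
          (T.dist_le_diam (hmem i t ht) (T.vertex_mem 0)) (by positivity)))
      (hε₀.le.trans (he _ (T.vertex_mem 0))) (heM _ (T.vertex_mem 0))
      (fun t ht => hζ _ (hmem i t ht)) (T.dist_le_diam (T.vertex_mem _) (T.vertex_mem _)) hh1 hθ
  have hvv : ∀ i, v (T i) = ℓ (T i) := fun i => hv (T.vertex_mem i)
  have main := sum_edge_lower_bound (ι := Fin 3) Finset.univ (fun i => edgeWeight T i (i + 1))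
    (fun i => harmonicAverage e ζ (T i) (T (i + 1)))
    (fun i => Real.exp (edgePotential e ζ (T i) (T (i + 1)) 1) - 1)
    (fun i => v (T (i + 1)) - v (T i)) (fun i => v (T (i + 1)))
    (m := e (T 0)) (A := T.area) (r := r) (h := h) (L := L) (G := ‖affGrad ℓ‖) (σ := σ) (μ := μ)
    (η := η) T.area_pos.le hr hh0 hL0 (norm_nonneg _) hη0 hσ
    (fun i _ => T.abs_edgeWeight_le hr hc _ _) (fun i _ => (hedge i).1) (fun i _ => (hedge i).2)
    (fun i _ => by
      rw [hvv, hvv]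
      exact T.abs_affine_sub_le ℓ (T.vertex_mem _) (T.vertex_mem _))
    (fun i _ => by
      rw [← hSA]
      exact T.area_mul_sq_le' hv (T.vertex_mem _))
  have hloc : localForm T e ζ v v = ∑ i : Fin 3, edgeWeight T i (i + 1) *
      harmonicAverage e ζ (T i) (T (i + 1)) * (v (T (i + 1)) - v (T i) +
      (Real.exp (edgePotential e ζ (T i) (T (i + 1)) 1) - 1) * v (T (i + 1))) *
      (v (T (i + 1)) - v (T i)) := by
    refine Finset.sum_congr rfl fun i _ => ?_
    rw [edgeDelta, edgePotential_zero, Real.exp_zero]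
    ring
  rw [hloc]
  refine le_trans ?_ main
  have hsum : ∑ i : Fin 3, edgeWeight T i (i + 1) * (v (T (i + 1)) - v (T i)) ^ 2 = S := by
    rw [hSA, ← T.sum_edgeWeight_mul_sq ℓ]
    simp only [hvv]
  rw [hsum, ← hSA]
  have hcard : ((Finset.univ : Finset (Fin 3)).card : ℝ) = 3 := by simp
  rw [hcard]
  have e1 : 3 * (σ ^ 2 * L * (h * S + η * S + (μ + h ^ 2 * S) / (2 * η))) =
      Q * h * S + Q * η * S + Q / (2 * η) * μ + Q * (h ^ 2 / (2 * η)) * S := by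
    rw [hQ]; ring
  rw [e1]
  have b1 : Q * h ≤ ε₀ / 8 := (mul_le_mul_of_nonneg_left hhη hQ0).trans hQη
  have b2 : Q * (h ^ 2 / (2 * η)) ≤ ε₀ / 8 := by
    refine le_trans (mul_le_mul_of_nonneg_left ?_ hQ0) hQη
    rw [div_le_iff₀ (by positivity)]
    nlinarith
  have b3 : ε₀ * S ≤ e (T 0) * S := mul_le_mul_of_nonneg_right (he _ (T.vertex_mem 0)) hS0
  have b4 : Q / (2 * η) * μ ≤ (Q + 1) / (2 * η) * μ := by gcongr; linarith
  have c1 := mul_le_mul_of_nonneg_right b1 hS0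
  have c2 := mul_le_mul_of_nonneg_right hQη hS0
  have c3 := mul_le_mul_of_nonneg_right b2 hS0
  have : 0 ≤ ε₀ * S := by positivity
  linarith

/-! ### The abstract saddle-point problem -/

section Saddle

variable {V ι : Type*} [AddCommGroup V] [Module ℝ V] [Fintype ι]

/-- A linear functional is bounded by any gauge that controls a separating set of coordinates. -/
theorem exists_bound_of_coords (ev : V →ₗ[ℝ] ι → ℝ) (hev : Function.Injective ev) {N : V → ℝ}
    (hN : ∀ v, 0 ≤ N v) {D : ℝ} (hD : 0 ≤ D) (hevN : ∀ v i, |ev v i| ≤ D * N v) (f : V →ₗ[ℝ] ℝ) :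
    ∃ B, 0 ≤ B ∧ ∀ v, |f v| ≤ B * N v := by
  -- Through a left inverse of `ev` the functional factors over `ι → ℝ`, where linear maps are
  -- continuous.
  obtain ⟨g, hg⟩ := ev.exists_leftInverse_of_injective (LinearMap.ker_eq_bot.2 hev)
  set F := LinearMap.toContinuousLinearMap (f ∘ₗ g) with hF
  refine ⟨‖F‖ * D, by positivity, fun v => ?_⟩
  have h1 : f v = F (ev v) := by
    have := LinearMap.congr_fun hg v
    simp only [LinearMap.comp_apply, LinearMap.id_apply] at this
    simp [hF, this]
  rw [h1, ← Real.norm_eq_abs, mul_assoc]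
  refine (F.le_opNorm _).trans (mul_le_mul_of_nonneg_left ?_ (norm_nonneg _))
  exact (pi_norm_le_iff_of_nonneg (mul_nonneg hD (hN v))).2 (hevN v)

/-- The saddle-point form of a pair of bilinear forms, as a linear map into the dual. -/
def saddleMap (a m : V →ₗ[ℝ] V →ₗ[ℝ] ℝ) : V × V →ₗ[ℝ] V × V →ₗ[ℝ] ℝ :=
  LinearMap.mk₂ ℝ (fun x w => a w.1 x.1 - m x.2 w.1 - m x.1 w.2 - a x.2 w.2)
    (fun x x' w => by simp only [Prod.fst_add, Prod.snd_add, map_add, LinearMap.add_apply]; ring)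
    (fun c x w => by
      simp only [Prod.smul_fst, Prod.smul_snd, map_smul, LinearMap.smul_apply, smul_eq_mul]; ring)
    (fun x w w' => by simp only [Prod.fst_add, Prod.snd_add, map_add, LinearMap.add_apply]; ring)
    (fun c x w => by
      simp only [Prod.smul_fst, Prod.smul_snd, map_smul, LinearMap.smul_apply, smul_eq_mul]; ring)

theorem saddleMap_apply (a m : V →ₗ[ℝ] V →ₗ[ℝ] ℝ) (x w : V × V) :
    saddleMap a m x w = a w.1 x.1 - m x.2 w.1 - m x.1 w.2 - a x.2 w.2 := rfl

variable (a m : V →ₗ[ℝ] V →ₗ[ℝ] ℝ) (hm : ∀ u v, m u v = m v u) {N : V → ℝ}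
  (hN : ∀ v, 0 ≤ N v) (hNq : ∀ (k l : ℝ) u v, N (k • u + l • v) ^ 2 ≤
    2 * k ^ 2 * N u ^ 2 + 2 * l ^ 2 * N v ^ 2)
  {c K : ℝ} (hc : 0 < c) (hK : 0 < K) (hG : ∀ v, c * N v ^ 2 ≤ a v v + K * m v v)

/-- The test pair `(p - K y, -y - K p)`. The contribution of `(-y, -p)` to the saddle-point form is
`m y y + m p p`, so that Gårding's inequality for `a` suffices and its coercivity is not needed. -/
def saddleTest (K : ℝ) (x : V × V) : V × V :=
  ((1 : ℝ) • x.1 + (-K) • x.2, (-1 : ℝ) • x.2 + (-K) • x.1)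

include hm hc hG in
-- The terms `∓K a(y,p)` cancel, as do `m(y,p)` and `m(p,y)` by symmetry. What is left is Gårding's
-- expression for `p` and for `y`; the factor `1/2` is from `(s + t)² ≤ 2s² + 2t²`.
theorem le_saddleMap_saddleTest (x : V × V) :
    c / 2 * (N x.1 + N x.2) ^ 2 ≤ saddleMap a m x (saddleTest K x) := by
  have e : saddleMap a m x (saddleTest K x) =
      (a x.1 x.1 + K * m x.1 x.1) + (a x.2 x.2 + K * m x.2 x.2) := by
    simp only [saddleMap_apply, saddleTest, map_add, map_smul, LinearMap.add_apply,
      LinearMap.smul_apply, smul_eq_mul, hm x.2 x.1]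
    ring
  rw [e]
  have h1 := hG x.1
  have h2 := hG x.2
  have h3 : 0 ≤ c * (N x.1 - N x.2) ^ 2 := by positivity
  linarith [show c / 2 * (N x.1 + N x.2) ^ 2 =
    c * N x.1 ^ 2 + c * N x.2 ^ 2 - c * (N x.1 - N x.2) ^ 2 / 2 by ring]

/-- Turns `hNq` into a triangle inequality up to the factor two, which is all that is required of
the gauge `N`. -/
theorem le_of_sq_le_quasi {n k l P Y : ℝ} (hP : 0 ≤ P) (hY : 0 ≤ Y)
    (h : n ^ 2 ≤ 2 * k ^ 2 * P ^ 2 + 2 * l ^ 2 * Y ^ 2) : n ≤ 2 * (|k| * P + |l| * Y) := by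
  refine le_of_sq_le_sq ?_ (by positivity)
  rw [← sq_abs k, ← sq_abs l] at h
  refine h.trans ?_
  have h1 : 0 ≤ |k| * P := by positivity
  have h2 : 0 ≤ |l| * Y := by positivity
  nlinarith [mul_nonneg h1 h2, sq_nonneg (|k| * P), sq_nonneg (|l| * Y)]

include hN hNq hK in
theorem gauge_saddleTest_le (x : V × V) :
    N (saddleTest K x).1 + N (saddleTest K x).2 ≤ 2 * (1 + K) * (N x.1 + N x.2) := by
  have h1 := le_of_sq_le_quasi (hN _) (hN _) (hNq 1 (-K) x.1 x.2)
  have h2 := le_of_sq_le_quasi (hN _) (hN _) (hNq (-1) (-K) x.2 x.1)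
  rw [abs_neg, abs_of_pos hK, abs_one] at h1
  rw [abs_neg, abs_neg, abs_of_pos hK, abs_one] at h2
  simp only [saddleTest]
  linarith

include hm hN hNq hc hK hG in
/-- A functional bound on a solution of the saddle-point problem. -/
theorem saddle_apriori {f : V → ℝ} {F : ℝ} (hF : ∀ q, |f q| ≤ F * N q) (hF0 : 0 ≤ F) {x : V × V}
    (hx : ∀ w, saddleMap a m x w = f w.1) : c / (4 * (1 + K)) * (N x.1 + N x.2) ≤ F := by
  have h1 := le_saddleMap_saddleTest a m hm hc hG x
  have h2 := gauge_saddleTest_le hN hNq hK x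
  rw [hx] at h1
  have h3 : f (saddleTest K x).1 ≤ F * (2 * (1 + K) * (N x.1 + N x.2)) := by
    refine (le_abs_self _).trans ((hF _).trans (mul_le_mul_of_nonneg_left ?_ hF0))
    linarith [hN (saddleTest K x).2]
  set n := N x.1 + N x.2 with hn
  have hn0 : 0 ≤ n := add_nonneg (hN _) (hN _)
  rcases hn0.eq_or_lt with h0 | h0
  · rw [← h0, mul_zero]; exact hF0
  · have h4 : (c / 2 * n) * n ≤ (F * (2 * (1 + K))) * n := by nlinarith
    have h5 := le_of_mul_le_mul_right h4 h0
    rw [div_mul_eq_mul_div, div_le_iff₀ (by positivity)]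
    linarith

variable (ev : V →ₗ[ℝ] ι → ℝ) (hev : Function.Injective ev) {D : ℝ} (hD : 0 ≤ D)
  (hevN : ∀ v i, |ev v i| ≤ D * N v)

include hev hN hD hevN in
theorem exists_saddleMap_bound (x : V × V) :
    ∃ B, 0 ≤ B ∧ ∀ w, |saddleMap a m x w| ≤ B * (N w.1 + N w.2) := by
  obtain ⟨B₁, hB₁, h₁⟩ := exists_bound_of_coords ev hev hN hD hevN
    (saddleMap a m x ∘ₗ LinearMap.inl ℝ V V)
  obtain ⟨B₂, hB₂, h₂⟩ := exists_bound_of_coords ev hev hN hD hevN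
    (saddleMap a m x ∘ₗ LinearMap.inr ℝ V V)
  refine ⟨B₁ + B₂, by positivity, fun w => ?_⟩
  have e : saddleMap a m x w = (saddleMap a m x ∘ₗ LinearMap.inl ℝ V V) w.1 +
      (saddleMap a m x ∘ₗ LinearMap.inr ℝ V V) w.2 := by
    rw [LinearMap.comp_apply, LinearMap.comp_apply, ← map_add]
    simp
  rw [e]
  refine (abs_add_le _ _).trans ((add_le_add (h₁ _) (h₂ _)).trans ?_)
  nlinarith [mul_nonneg hB₁ (hN w.2), mul_nonneg hB₂ (hN w.1)]

include hm hN hNq hc hK hG hev hD hevN in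
-- The constant is the lower bound `c/2` at the test pair divided by the bound `2(1 + K)` on its
-- gauge. The upper bound `B` may depend on `x` and on the mesh: it only makes the supremum finite.
theorem saddle_infSup (x : V × V) :
    BddAbove (range fun w : V × V => saddleMap a m x w / (N w.1 + N w.2)) ∧
    c / (4 * (1 + K)) * (N x.1 + N x.2) ≤
      ⨆ w : V × V, saddleMap a m x w / (N w.1 + N w.2) := by
  obtain ⟨B, hB, hbd⟩ := exists_saddleMap_bound a m hN ev hev hD hevN x
  have hbdd : BddAbove (range fun w : V × V => saddleMap a m x w / (N w.1 + N w.2)) := by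
    refine ⟨B, ?_⟩
    rintro _ ⟨w, rfl⟩
    exact div_le_of_le_mul₀ (add_nonneg (hN _) (hN _)) hB ((le_abs_self _).trans (hbd w))
  refine ⟨hbdd, ?_⟩
  refine le_trans ?_ (le_ciSup hbdd (saddleTest K x))
  have h1 := le_saddleMap_saddleTest a m hm hc hG x
  have h2 := gauge_saddleTest_le hN hNq hK x
  have h3 := (le_abs_self _).trans (hbd (saddleTest K x))
  change _ ≤ saddleMap a m x (saddleTest K x) / (N (saddleTest K x).1 + N (saddleTest K x).2)
  set n := N x.1 + N x.2 with hn
  set d := N (saddleTest K x).1 + N (saddleTest K x).2 with hd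
  have hn0 : 0 ≤ n := add_nonneg (hN _) (hN _)
  have hd0 : 0 ≤ d := add_nonneg (hN _) (hN _)
  rcases hn0.eq_or_lt with h0 | h0
  -- If `x` has gauge zero, it suffices that the quotient is nonnegative, which includes the value
  -- `0` of division by zero.
  · rw [← h0] at h1 ⊢
    rw [mul_zero]
    exact div_nonneg (by simpa using h1) hd0
  -- Boundedness forces this: if `d = 0`, the form would vanish at the test pair, against its
  -- positive lower bound.
  · have hdpos : 0 < d := by
      by_contra hcon
      have : d = 0 := le_antisymm (not_lt.1 hcon) hd0
      rw [this, mul_zero] at h3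
      have : 0 < c / 2 * n ^ 2 := by positivity
      linarith
    rw [le_div_iff₀ hdpos]
    calc c / (4 * (1 + K)) * n * d ≤ c / (4 * (1 + K)) * n * (2 * (1 + K) * n) := by gcongr
      _ = c / 2 * n ^ 2 := by
          field_simp
          ring
      _ ≤ _ := h1

include hm hN hNq hc hK hG hev hevN in
-- The a priori bound with zero data gives injectivity into the dual, which has the same finite
-- dimension, hence surjectivity.
theorem saddle_existsUnique (f : V →ₗ[ℝ] ℝ) :
    ∃! x : V × V, ∀ w, saddleMap a m x w = f w.1 := by
  have : FiniteDimensional ℝ V := Module.Finite.of_injective ev hev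
  have hinj : Function.Injective (saddleMap a m) := by
    rw [← LinearMap.ker_eq_bot, LinearMap.ker_eq_bot']
    intro x hx
    have h := saddle_apriori a m hm hN hNq hc hK hG (f := fun _ => 0) (F := 0) (x := x)
      (fun q => by simp) le_rfl (fun w => by rw [hx]; rfl)
    have hpos : 0 < c / (4 * (1 + K)) := by positivity
    have hs : N x.1 + N x.2 ≤ 0 := by
      by_contra hcon
      exact absurd h (not_le.2 (mul_pos hpos (not_le.1 hcon)))
    have hz : ∀ v, N v = 0 → v = 0 := fun v hv => hev (by
      ext i
      have := hevN v i
      rw [hv, mul_zero] at this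
      simpa using abs_nonpos_iff.1 this)
    have := hN x.1
    have := hN x.2
    exact Prod.ext (hz _ (by linarith)) (hz _ (by linarith))
  have hsurj : Function.Surjective (saddleMap a m) :=
    (LinearMap.injective_iff_surjective_of_finrank_eq_finrank
      (V₂ := Module.Dual ℝ (V × V)) Subspace.dual_finrank_eq.symm).1 hinj
  obtain ⟨x, hx⟩ := hsurj (f ∘ₗ LinearMap.fst ℝ V V)
  refine ⟨x, fun w => by rw [hx]; rfl, fun y hy => hinj ?_⟩
  rw [hx]
  exact LinearMap.ext fun w => hy w

end Saddle

/-! ### The domain and its triangulations -/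

namespace IsConvexPolygonalDomain

variable {Ω : Set Plane} (hΩ : IsConvexPolygonalDomain Ω)
include hΩ

theorem isOpen : IsOpen Ω := by
  obtain ⟨-, S, rfl⟩ := hΩ
  exact isOpen_interior

theorem convex : Convex ℝ Ω := by
  obtain ⟨-, S, rfl⟩ := hΩ
  exact (convex_convexHull ℝ _).interior

theorem isCompact_closure : IsCompact (closure Ω) := by
  obtain ⟨-, S, rfl⟩ := hΩ
  have h := S.finite_toSet.isCompact_convexHull ℝ
  exact h.of_isClosed_subset isClosed_closure
    (closure_minimal interior_subset h.isClosed)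

theorem ae_eq_closure : (Ω : Set Plane) =ᵐ[volume] closure Ω :=
  (closure_ae_eq_of_null_frontier (hΩ.convex.addHaar_frontier volume)).symm

theorem interior_closure : interior (closure Ω) = Ω := by
  have h := hΩ.isOpen.interior_eq
  rw [hΩ.convex.interior_closure_eq_interior_of_nonempty_interior (by rw [h]; exact hΩ.1), h]

end IsConvexPolygonalDomain

namespace Triangulation

variable {Ω : Set Plane} (𝒯 : Triangulation Ω)

theorem carrier_subset {T : Triangle} (hT : T ∈ 𝒯.elems) : T.carrier ⊆ closure Ω := by
  rw [← 𝒯.cover]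
  exact subset_biUnion_of_mem (u := fun T : Triangle => T.carrier) hT

theorem interior_subset (hΩ : IsConvexPolygonalDomain Ω) {T : Triangle} (hT : T ∈ 𝒯.elems) :
    interior T.carrier ⊆ Ω := by
  rw [← hΩ.interior_closure]
  exact interior_mono (𝒯.carrier_subset hT)

theorem ae_eq_biUnion_interior (hΩ : IsConvexPolygonalDomain Ω) :
    (Ω : Set Plane) =ᵐ[volume] ⋃ T ∈ 𝒯.elems, interior (T : Triangle).carrier := by
  refine hΩ.ae_eq_closure.trans ?_
  rw [← 𝒯.cover]
  exact ae_eq_set_biUnion (s := (𝒯.elems : Set Triangle)) 𝒯.elems.countable_toSet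
    fun T _ => T.interior_ae_eq.symm

theorem integrableOn_iff (hΩ : IsConvexPolygonalDomain Ω) {f : Plane → ℝ} :
    IntegrableOn f Ω ↔ ∀ T ∈ 𝒯.elems, IntegrableOn f T.carrier := by
  rw [integrableOn_congr_set_ae hΩ.ae_eq_closure, ← 𝒯.cover, integrableOn_finset_iUnion]

/-- Closed triangles overlap along edges, so the sum is taken over the disjoint open ones;
boundaries of convex sets are null. -/
theorem setIntegral_eq_sum (hΩ : IsConvexPolygonalDomain Ω) {f : Plane → ℝ}
    (hf : ∀ T ∈ 𝒯.elems, IntegrableOn f T.carrier) :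
    ∫ x in Ω, f x = ∑ T ∈ 𝒯.elems, ∫ x in T.carrier, f x := by
  rw [setIntegral_congr_set (𝒯.ae_eq_biUnion_interior hΩ), integral_biUnion_finset]
  · exact Finset.sum_congr rfl fun T _ => setIntegral_congr_set T.interior_ae_eq
  · exact fun T _ => isOpen_interior.measurableSet
  · exact fun T hT T' hT' h => 𝒯.disjoint_interior T hT T' hT' h
  · exact fun T hT => (hf T hT).mono_set _root_.interior_subset

theorem ae_restrict_iff (hΩ : IsConvexPolygonalDomain Ω) {p : Plane → Prop} :
    (∀ᵐ x ∂volume.restrict Ω, p x) ↔ ∀ T ∈ 𝒯.elems, ∀ᵐ x ∂volume.restrict T.carrier, p x := by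
  rw [Measure.restrict_congr_set hΩ.ae_eq_closure, ← 𝒯.cover, ae_restrict_biUnion_finset_iff]

theorem diam_le_meshSize {T : Triangle} (hT : T ∈ 𝒯.elems) :
    Metric.diam T.carrier ≤ 𝒯.meshSize :=
  le_ciSup (f := fun T : 𝒯.elems => Metric.diam (T : Triangle).carrier)
    (finite_range _).bddAbove ⟨T, hT⟩

/-! ### The finite element space -/

section FemSpace

variable {𝒯} (hΩ : IsConvexPolygonalDomain Ω)

theorem femSpace_continuous (v : 𝒯.femSpace) : Continuous (v : Plane → ℝ) := v.2.1

theorem femSpace_affine (v : 𝒯.femSpace) {T : Triangle} (hT : T ∈ 𝒯.elems) :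
    ∃ ℓ : Plane →ᵃ[ℝ] ℝ, EqOn (v : Plane → ℝ) ℓ T.carrier := v.2.2.2 T hT

include hΩ in
theorem _root_.EAFE.IsConvexPolygonalDomain.integrableOn_of_continuous {f : Plane → ℝ}
    (hf : Continuous f) : IntegrableOn f Ω :=
  (hf.continuousOn.integrableOn_compact hΩ.isCompact_closure).mono_set subset_closure

include hΩ in
theorem integrableOn_gradient_sq (v : 𝒯.femSpace) :
    IntegrableOn (fun x => ‖gradient (v : Plane → ℝ) x‖ ^ 2) Ω :=
  (𝒯.integrableOn_iff hΩ).2 fun T hT => by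
    obtain ⟨ℓ, hℓ⟩ := femSpace_affine v hT
    exact T.integrableOn_gradient_sq hℓ

theorem h1Norm_sq (v : Plane → ℝ) :
    h1Norm Ω v ^ 2 = (∫ x in Ω, v x ^ 2) + ∫ x in Ω, ‖gradient v x‖ ^ 2 :=
  Real.sq_sqrt (add_nonneg (integral_nonneg fun _ => by positivity)
    (integral_nonneg fun _ => by positivity))

include hΩ in
-- Integrates `(s + t)² ≤ 2s² + 2t²` for values and gradients; it plays the role of the triangle
-- inequality for `h1Norm`.
theorem h1Norm_combination_sq_le (k l : ℝ) (u v : 𝒯.femSpace) :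
    h1Norm Ω (k • u + l • v : 𝒯.femSpace) ^ 2 ≤
      2 * k ^ 2 * h1Norm Ω u ^ 2 + 2 * l ^ 2 * h1Norm Ω v ^ 2 := by
  have hu : IntegrableOn (fun x => (u : Plane → ℝ) x ^ 2) Ω :=
    hΩ.integrableOn_of_continuous ((femSpace_continuous u).pow 2)
  have hv : IntegrableOn (fun x => (v : Plane → ℝ) x ^ 2) Ω :=
    hΩ.integrableOn_of_continuous ((femSpace_continuous v).pow 2)
  have hw : IntegrableOn (fun x => ((k • u + l • v : 𝒯.femSpace) : Plane → ℝ) x ^ 2) Ω :=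
    hΩ.integrableOn_of_continuous ((femSpace_continuous (k • u + l • v)).pow 2)
  have gu := integrableOn_gradient_sq hΩ u
  have gv := integrableOn_gradient_sq hΩ v
  have gw := integrableOn_gradient_sq hΩ (k • u + l • v)
  have h1 : ∫ x in Ω, ((k • u + l • v : 𝒯.femSpace) : Plane → ℝ) x ^ 2 ≤
      ∫ x in Ω, (2 * k ^ 2 * (u : Plane → ℝ) x ^ 2 + 2 * l ^ 2 * (v : Plane → ℝ) x ^ 2) := by
    refine integral_mono hw ((hu.const_mul _).add (hv.const_mul _)) fun x => ?_
    change (k * (u : Plane → ℝ) x + l * (v : Plane → ℝ) x) ^ 2 ≤ _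
    nlinarith [sq_nonneg (k * (u : Plane → ℝ) x - l * (v : Plane → ℝ) x)]
  have h2 : ∫ x in Ω, ‖gradient ((k • u + l • v : 𝒯.femSpace) : Plane → ℝ) x‖ ^ 2 ≤
      ∫ x in Ω, (2 * k ^ 2 * ‖gradient (u : Plane → ℝ) x‖ ^ 2 +
        2 * l ^ 2 * ‖gradient (v : Plane → ℝ) x‖ ^ 2) := by
    refine integral_mono_ae gw ((gu.const_mul _).add (gv.const_mul _)) ?_
    -- The classical gradient is linear only where both functions are differentiable, hence the
    -- passage to single triangles.
    refine (𝒯.ae_restrict_iff hΩ).2 fun T hT => ?_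
    obtain ⟨ℓ, hℓ⟩ := femSpace_affine u hT
    obtain ⟨ℓ', hℓ'⟩ := femSpace_affine v hT
    filter_upwards [T.ae_gradient_eq hℓ, T.ae_gradient_eq hℓ'] with x hx hx'
    have hs : HasGradientAt ((k • u + l • v : 𝒯.femSpace) : Plane → ℝ)
        (k • affGrad ℓ + l • affGrad ℓ') x := by
      rw [hasGradientAt_iff_hasFDerivAt] at hx hx' ⊢
      rw [map_add, map_smul, map_smul]
      exact (hx.const_smul k).add (hx'.const_smul l)
    rw [hs.gradient, hx.gradient, hx'.gradient]
    have n1 := norm_add_le (k • affGrad ℓ) (l • affGrad ℓ')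
    rw [norm_smul, norm_smul, Real.norm_eq_abs, Real.norm_eq_abs] at n1
    rw [← sq_abs k, ← sq_abs l]
    calc ‖k • affGrad ℓ + l • affGrad ℓ'‖ ^ 2 ≤ (|k| * ‖affGrad ℓ‖ + |l| * ‖affGrad ℓ'‖) ^ 2 := by
          gcongr
      _ ≤ _ := by nlinarith [sq_nonneg (|k| * ‖affGrad ℓ‖ - |l| * ‖affGrad ℓ'‖)]
  rw [integral_add (hu.const_mul _) (hv.const_mul _), integral_const_mul,
    integral_const_mul] at h1
  rw [integral_add (gu.const_mul _) (gv.const_mul _), integral_const_mul,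
    integral_const_mul] at h2
  rw [h1Norm_sq, h1Norm_sq, h1Norm_sq]
  linarith

variable (𝒯) in
/-- Evaluation at the vertices of all elements. -/
def nodalEval : 𝒯.femSpace →ₗ[ℝ] 𝒯.elems × Fin 3 → ℝ where
  toFun v i := (v : Plane → ℝ) ((i.1 : Triangle) i.2)
  map_add' _ _ := rfl
  map_smul' _ _ := rfl

theorem nodalEval_injective : Function.Injective 𝒯.nodalEval := by
  rw [← LinearMap.ker_eq_bot, LinearMap.ker_eq_bot']
  intro v hv
  refine Subtype.ext (funext fun x => ?_)
  change (v : Plane → ℝ) x = 0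
  by_cases hx : x ∈ Ω
  · have hx' : x ∈ ⋃ T ∈ 𝒯.elems, (T : Triangle).carrier := by
      rw [𝒯.cover]; exact subset_closure hx
    simp only [mem_iUnion] at hx'
    obtain ⟨T, hT, hxT⟩ := hx'
    obtain ⟨ℓ, hℓ⟩ := femSpace_affine v hT
    rw [hℓ hxT, T.affine_apply_eq]
    refine Finset.sum_eq_zero fun i _ => ?_
    have h0 : (v : Plane → ℝ) (T i) = 0 := congrFun hv (⟨T, hT⟩, i)
    rw [← hℓ (T.vertex_mem i), h0, mul_zero]
  · exact v.2.2.1 x hx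

include hΩ in
-- The constant depends on the mesh. This is harmless: it serves only for finiteness of the supremum
-- and definiteness of `h1Norm`, and does not enter the stability constant.
theorem exists_nodalEval_bound :
    ∃ D, 0 ≤ D ∧ ∀ (v : 𝒯.femSpace) i, |𝒯.nodalEval v i| ≤ D * h1Norm Ω v := by
  have hloc : ∀ i : 𝒯.elems × Fin 3, ∃ D, 0 ≤ D ∧
      ∀ v : 𝒯.femSpace, |𝒯.nodalEval v i| ≤ D * h1Norm Ω v := by
    rintro ⟨⟨T, hT⟩, i⟩
    set d := Metric.diam T.carrier with hd
    refine ⟨Real.sqrt ((2 + 2 * d ^ 2) / T.area), by positivity, fun v => ?_⟩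
    obtain ⟨ℓ, hℓ⟩ := femSpace_affine v hT
    have h1 := T.area_mul_sq_le' hℓ (T.vertex_mem i)
    have h2 : ∫ y in T.carrier, (v : Plane → ℝ) y ^ 2 ≤ ∫ y in Ω, (v : Plane → ℝ) y ^ 2 := by
      rw [← setIntegral_congr_set T.interior_ae_eq]
      exact setIntegral_mono_set (hΩ.integrableOn_of_continuous ((femSpace_continuous v).pow 2))
        (ae_of_all _ fun _ => by positivity) (𝒯.interior_subset hΩ hT).eventuallyLE
    have h3 : ∫ y in T.carrier, ‖gradient (v : Plane → ℝ) y‖ ^ 2 ≤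
        ∫ y in Ω, ‖gradient (v : Plane → ℝ) y‖ ^ 2 := by
      rw [← setIntegral_congr_set T.interior_ae_eq]
      exact setIntegral_mono_set (integrableOn_gradient_sq hΩ v)
        (ae_of_all _ fun _ => by positivity) (𝒯.interior_subset hΩ hT).eventuallyLE
    have h4 : T.area * (v : Plane → ℝ) (T i) ^ 2 ≤ (2 + 2 * d ^ 2) * h1Norm Ω v ^ 2 := by
      rw [h1Norm_sq]
      have p1 : 0 ≤ ∫ y in Ω, (v : Plane → ℝ) y ^ 2 := integral_nonneg fun _ => by positivity
      have p2 : 0 ≤ ∫ y in Ω, ‖gradient (v : Plane → ℝ) y‖ ^ 2 :=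
        integral_nonneg fun _ => by positivity
      have p3 := mul_le_mul_of_nonneg_left h3 (sq_nonneg d)
      have p4 := mul_nonneg (sq_nonneg d) p1
      linarith
    change |(v : Plane → ℝ) (T i)| ≤ _
    refine abs_le_of_sq_le_sq ?_ (mul_nonneg (Real.sqrt_nonneg _) (Real.sqrt_nonneg _))
    have hA := T.area_pos
    rw [mul_pow, Real.sq_sqrt (by positivity), div_mul_eq_mul_div, le_div_iff₀ hA]
    linarith
  choose D hD hb using hloc
  refine ⟨∑ i, D i, Finset.sum_nonneg fun i _ => hD i, fun v i => (hb i v).trans ?_⟩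
  exact mul_le_mul_of_nonneg_right
    (Finset.single_le_sum (fun j _ => hD j) (Finset.mem_univ i)) (Real.sqrt_nonneg _)

end FemSpace

end Triangulation

/-! ### Bilinearity -/

section Forms

variable {Ω : Set Plane} {𝒯 : Triangulation Ω}

theorem edgeDelta_add (ε : Plane → ℝ) (ζ : Plane → Plane) (x₀ x₁ : Plane) (y y' : Plane → ℝ) :
    edgeDelta ε ζ x₀ x₁ (y + y') = edgeDelta ε ζ x₀ x₁ y + edgeDelta ε ζ x₀ x₁ y' := by
  simp only [edgeDelta, Pi.add_apply]; ring

theorem edgeDelta_smul (ε : Plane → ℝ) (ζ : Plane → Plane) (x₀ x₁ : Plane) (c : ℝ)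
    (y : Plane → ℝ) : edgeDelta ε ζ x₀ x₁ (c • y) = c * edgeDelta ε ζ x₀ x₁ y := by
  simp only [edgeDelta, Pi.smul_apply, smul_eq_mul]; ring

/-- The edge-averaged form as a bilinear map. -/
def eafeBilin (𝒯 : Triangulation Ω) (e : Triangle → Plane → ℝ) (ζ : Plane → Plane) :
    𝒯.femSpace →ₗ[ℝ] 𝒯.femSpace →ₗ[ℝ] ℝ :=
  LinearMap.mk₂ ℝ (fun y v => eafeForm 𝒯 e ζ y v)
    (fun y y' v => by
      simp only [eafeForm, localForm, Submodule.coe_add, edgeDelta_add, ← Finset.sum_add_distrib]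
      refine Finset.sum_congr rfl fun T _ => Finset.sum_congr rfl fun i _ => by ring)
    (fun c y v => by
      simp only [eafeForm, localForm, Submodule.coe_smul, edgeDelta_smul, smul_eq_mul,
        Finset.mul_sum]
      refine Finset.sum_congr rfl fun T _ => Finset.sum_congr rfl fun i _ => by ring)
    (fun y v v' => by
      simp only [eafeForm, localForm, Submodule.coe_add, Pi.add_apply, ← Finset.sum_add_distrib]
      refine Finset.sum_congr rfl fun T _ => Finset.sum_congr rfl fun i _ => by ring)
    (fun c y v => by
      simp only [eafeForm, localForm, Submodule.coe_smul, Pi.smul_apply, smul_eq_mul,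
        Finset.mul_sum]
      refine Finset.sum_congr rfl fun T _ => Finset.sum_congr rfl fun i _ => by ring)

/-- A weighted `L²` inner product as a bilinear map. -/
def weightedBilin (𝒯 : Triangulation Ω) (γ : Plane → ℝ)
    (hγ : ∀ f : Plane → ℝ, Continuous f → IntegrableOn (fun x => γ x * f x) Ω) :
    𝒯.femSpace →ₗ[ℝ] 𝒯.femSpace →ₗ[ℝ] ℝ :=
  have hI : ∀ u v : 𝒯.femSpace,
      IntegrableOn (fun x => γ x * (u : Plane → ℝ) x * (v : Plane → ℝ) x) Ω := fun u v => by
    simpa only [mul_assoc, Pi.mul_apply] using hγ _ (u.2.1.mul v.2.1)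
  LinearMap.mk₂ ℝ (fun y v => ∫ x in Ω, γ x * (y : Plane → ℝ) x * (v : Plane → ℝ) x)
    (fun y y' v => by
      rw [← integral_add (hI y v) (hI y' v)]
      refine integral_congr_ae (ae_of_all _ fun x => ?_)
      simp only [Submodule.coe_add, Pi.add_apply]; ring)
    (fun c y v => by
      rw [← integral_smul]
      refine integral_congr_ae (ae_of_all _ fun x => ?_)
      simp only [Submodule.coe_smul, Pi.smul_apply, smul_eq_mul]; ring)
    (fun y v v' => by
      rw [← integral_add (hI y v) (hI y v')]
      refine integral_congr_ae (ae_of_all _ fun x => ?_)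
      simp only [Submodule.coe_add, Pi.add_apply]; ring)
    (fun c y v => by
      rw [← integral_smul]
      refine integral_congr_ae (ae_of_all _ fun x => ?_)
      simp only [Submodule.coe_smul, Pi.smul_apply, smul_eq_mul]; ring)

/-- The `L²` inner product as a bilinear map. -/
def l2Bilin (hΩ : IsConvexPolygonalDomain Ω) (𝒯 : Triangulation Ω) :
    𝒯.femSpace →ₗ[ℝ] 𝒯.femSpace →ₗ[ℝ] ℝ :=
  weightedBilin 𝒯 (fun _ => 1) fun f hf => by
    simpa using hΩ.integrableOn_of_continuous hf

theorem l2Bilin_apply (hΩ : IsConvexPolygonalDomain Ω) (u v : 𝒯.femSpace) :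
    l2Bilin hΩ 𝒯 u v = l2Inner Ω u v := by
  simp [l2Bilin, weightedBilin, l2Inner]

theorem MemW1Inf.integrableOn_mul (hΩ : IsConvexPolygonalDomain Ω) {γ : Plane → ℝ}
    (hγ : MemW1Inf Ω γ) (f : Plane → ℝ) (hf : Continuous f) :
    IntegrableOn (fun x => γ x * f x) Ω := by
  obtain ⟨M, hm, hb, -⟩ := hγ
  exact (hΩ.integrableOn_of_continuous hf).bdd_mul hm hb

theorem memLp_two_of_continuous (hΩ : IsConvexPolygonalDomain Ω) {f : Plane → ℝ}
    (hf : Continuous f) : MemLp f 2 (volume.restrict Ω) :=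
  (memLp_two_iff_integrable_sq hf.aestronglyMeasurable).2
    (hΩ.integrableOn_of_continuous (hf.pow 2))

theorem abs_l2Inner_le {f g : Plane → ℝ} (hf : MemLp f 2 (volume.restrict Ω))
    (hg : MemLp g 2 (volume.restrict Ω)) : |l2Inner Ω f g| ≤ l2Norm Ω f * l2Norm Ω g := by
  have h2 : ENNReal.ofReal 2 = 2 := by simp
  have h := integral_mul_norm_le_Lp_mul_Lq (μ := volume.restrict Ω) (f := f) (g := g)
    Real.HolderConjugate.two_two (by rwa [h2]) (by rwa [h2])
  have e : ∀ f : Plane → ℝ, (∫ a in Ω, ‖f a‖ ^ (2 : ℝ)) ^ (1 / (2 : ℝ)) = l2Norm Ω f := fun f => by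
    rw [← Real.sqrt_eq_rpow, l2Norm, l2Inner]
    congr 1
    refine integral_congr_ae (ae_of_all _ fun x => ?_)
    simp only [Real.rpow_two, Real.norm_eq_abs, sq_abs]
    ring
  rw [e, e] at h
  refine le_trans ?_ h
  rw [l2Inner, ← Real.norm_eq_abs]
  simpa only [norm_mul] using norm_integral_le_integral_norm (μ := volume.restrict Ω)
    fun x => f x * g x

theorem l2Norm_le_h1Norm (v : Plane → ℝ) : l2Norm Ω v ≤ h1Norm Ω v := by
  refine Real.sqrt_le_sqrt ?_
  rw [l2Inner]
  simp only [← sq]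
  exact le_add_of_nonneg_right (integral_nonneg fun _ => by positivity)

/-- The functional `q ↦ -(y_d, q)` on the finite element space. -/
def dataFunctional (hΩ : IsConvexPolygonalDomain Ω) (𝒯 : Triangulation Ω) {y_d : Plane → ℝ}
    (hy : MemLp y_d 2 (volume.restrict Ω)) : 𝒯.femSpace →ₗ[ℝ] ℝ where
  toFun q := -l2Inner Ω y_d q
  map_add' q q' := by
    have hI : ∀ q : 𝒯.femSpace, Integrable (fun x => y_d x * (q : Plane → ℝ) x)
        (volume.restrict Ω) := fun q => hy.integrable_mul (memLp_two_of_continuous hΩ q.2.1)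
    rw [← neg_add, l2Inner, l2Inner, l2Inner, ← integral_add (hI q) (hI q')]
    refine congrArg _ (integral_congr_ae (ae_of_all _ fun x => ?_))
    simp only [Submodule.coe_add, Pi.add_apply]; ring
  map_smul' c q := by
    rw [smul_neg, l2Inner, l2Inner, RingHom.id_apply, ← integral_smul]
    refine congrArg _ (integral_congr_ae (ae_of_all _ fun x => ?_))
    simp only [Submodule.coe_smul, Pi.smul_apply, smul_eq_mul]; ring

end Forms

/-! ### Gårding's inequality on the mesh -/

/-- Bounds and Lipschitz continuity of the elementwise representative of the diffusion. -/
theorem IsElementwiseW1Inf.bounds {Ω : Set Plane} (hΩ : IsConvexPolygonalDomain Ω)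
    {𝒯 : Triangulation Ω} {ε : Plane → ℝ} {e : Triangle → Plane → ℝ} {M ε₀ : ℝ}
    (he : IsElementwiseW1Inf 𝒯 ε e M) (hε : ∀ᵐ x ∂volume.restrict Ω, ε₀ ≤ ε x)
    {T : Triangle} (hT : T ∈ 𝒯.elems) :
    (∀ x ∈ T.carrier, ε₀ ≤ e T x) ∧ (∀ x ∈ T.carrier, e T x ≤ |M|) ∧
      ∀ x ∈ T.carrier, ∀ y ∈ T.carrier, |e T x - e T y| ≤ 2 * |M| * ‖x - y‖ := by
  obtain ⟨hc, hae, hW⟩ := he T hT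
  have hsub := interior_subset (s := T.carrier)
  have hci := hc.mono hsub
  have hae' : ∀ᵐ x ∂volume.restrict (interior T.carrier), e T x = ε x :=
    ae_restrict_of_ae_restrict_of_subset hsub hae
  have hε' : ∀ᵐ x ∂volume.restrict (interior T.carrier), ε₀ ≤ ε x :=
    ae_restrict_of_ae_restrict_of_subset (𝒯.interior_subset hΩ hT) hε
  have hdense : T.carrier ⊆ closure (interior T.carrier) := T.closure_interior.ge
  -- Bounds pass by continuity from the interior to the closed triangle, where the edges lie. The
  -- Lipschitz bound is extended below in one variable at a time.
  have hext : ∀ {f : Plane → ℝ} {c : ℝ}, ContinuousOn f T.carrier →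
      (∀ x ∈ interior T.carrier, f x ≤ c) → ∀ x ∈ T.carrier, f x ≤ c := by
    intro f c hf h x hx
    have h1 : f x ∈ closure (f '' interior T.carrier) :=
      ((hf x hx).mono hsub).mem_closure_image (hdense hx)
    exact closure_minimal (t := Iic c) (image_subset_iff.2 fun x hx => h x hx) isClosed_Iic h1
  have hlow : ∀ x ∈ T.carrier, -e T x ≤ -ε₀ :=
    hext hc.neg (le_of_ae_le_of_isOpen isOpen_interior hci.neg (by
      filter_upwards [hae', hε'] with x h1 h2
      rw [h1]; linarith))
  have hup : ∀ x ∈ T.carrier, e T x ≤ |M| :=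
    hext hc (le_of_ae_le_of_isOpen isOpen_interior hci (by
      filter_upwards [hae', hW.2.1] with x h1 h2
      rw [h1]
      exact (le_abs_self _).trans (h2.trans (le_abs_self _))))
  have hlip : ∀ x ∈ interior T.carrier, ∀ y ∈ interior T.carrier,
      |e T x - e T y| - 2 * |M| * ‖x - y‖ ≤ 0 := fun x hx y hy => by
    have h1 := abs_sub_le_of_hasW1InfBound isOpen_interior T.convex_carrier.interior hci hae' hW
      hy hx
    have h2 : 2 * M * ‖x - y‖ ≤ 2 * |M| * ‖x - y‖ := by
      gcongr
      exact le_abs_self M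
    linarith
  refine ⟨fun x hx => by linarith [hlow x hx], hup, fun x hx y hy => ?_⟩
  have h1 : ∀ x ∈ interior T.carrier, ∀ y ∈ T.carrier,
      |e T x - e T y| - 2 * |M| * ‖x - y‖ ≤ 0 := fun x hx =>
    hext ((continuousOn_const.sub hc).abs.sub
      (continuousOn_const.mul (continuousOn_const.sub continuousOn_id).norm)) (hlip x hx)
  have h2 := hext (f := fun x => |e T x - e T y| - 2 * |M| * ‖x - y‖)
    ((hc.sub continuousOn_const).abs.sub
      (continuousOn_const.mul (continuousOn_id.sub continuousOn_const).norm))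
    (fun x hx => h1 x hx y hy) x hx
  linarith

/-- The discrete Gårding inequality for the edge-averaged form. -/
theorem exists_eafeForm_garding {Ω : Set Plane} (hΩ : IsConvexPolygonalDomain Ω) {ε : Plane → ℝ}
    {ζ : Plane → Plane} {ε₀ : ℝ} (hε₀ : 0 < ε₀) (hε : ∀ᵐ x ∂volume.restrict Ω, ε₀ ≤ ε x)
    (hζ : ContinuousOn ζ (closure Ω)) (σ M : ℝ) :
    ∃ K > 0, ∃ h₀ > 0, ∀ (𝒯 : Triangulation Ω) (e : Triangle → Plane → ℝ),
      𝒯.ShapeRegular σ → IsElementwiseW1Inf 𝒯 ε e M → 𝒯.meshSize ≤ h₀ → ∀ v : 𝒯.femSpace,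
        ε₀ / 2 * h1Norm Ω v ^ 2 ≤ eafeForm 𝒯 e ζ v v + K * l2Inner Ω v v := by
  obtain ⟨Z, hZ⟩ := hΩ.isCompact_closure.exists_bound_of_continuousOn hζ
  have hZ0 : 0 ≤ Z := by
    obtain ⟨x, hx⟩ := hΩ.1
    exact (norm_nonneg _).trans (hZ x (subset_closure hx))
  obtain ⟨K, hK, h₀, hh₀, hloc⟩ := exists_localForm_lower_bound σ hε₀ (abs_nonneg M) hZ0
  -- The extra `ε₀/2` supplies the `L²` part of the full `H¹` norm.
  refine ⟨K + ε₀ / 2, by positivity, h₀, hh₀, fun 𝒯 e hσ he hh v => ?_⟩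
  have hsum : ε₀ / 2 * (∫ x in Ω, ‖gradient (v : Plane → ℝ) x‖ ^ 2) -
      K * (∫ x in Ω, (v : Plane → ℝ) x ^ 2) ≤ eafeForm 𝒯 e ζ v v := by
    rw [𝒯.setIntegral_eq_sum hΩ
        ((𝒯.integrableOn_iff hΩ).1 (Triangulation.integrableOn_gradient_sq hΩ v)),
      𝒯.setIntegral_eq_sum hΩ (f := fun x => (v : Plane → ℝ) x ^ 2)
        ((𝒯.integrableOn_iff hΩ).1 (hΩ.integrableOn_of_continuous (v.2.1.pow 2))),
      Finset.mul_sum, Finset.mul_sum, ← Finset.sum_sub_distrib]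
    refine Finset.sum_le_sum fun T hT => ?_
    obtain ⟨c, r, hr, hball, hdiam⟩ := hσ T hT
    obtain ⟨b₁, b₂, b₃⟩ := he.bounds hΩ hε hT
    obtain ⟨ℓ, hℓ⟩ := Triangulation.femSpace_affine v hT
    exact hloc T (e T) ζ c r hr hball hdiam ((𝒯.diam_le_meshSize hT).trans hh) (he T hT).1 b₁ b₂ b₃
      (hζ.mono (𝒯.carrier_subset hT)) (fun x hx => hZ x (𝒯.carrier_subset hT hx)) v ℓ hℓ
  have hl2 : l2Inner Ω v v = ∫ x in Ω, (v : Plane → ℝ) x ^ 2 := by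
    simp only [l2Inner, sq]
  rw [Triangulation.h1Norm_sq, hl2]
  linarith

end EAFE

end

/-! ### The inf-sup condition and well-posedness -/

open EAFE
theorem lemma4p1
    (Ω : Set Plane) (hΩ : IsConvexPolygonalDomain Ω)
    (ε : Plane → ℝ) (ζ : Plane → Plane) (γ divζ : Plane → ℝ) (ε₀ γ₀ : ℝ)
    (hε₀ : 0 < ε₀) (hε : ∀ᵐ x ∂volume.restrict Ω, ε₀ ≤ ε x)
    (hζ_cont : ContinuousOn ζ (closure Ω))
    (hζ : ∀ i : Fin 2, MemW1Inf Ω (fun x => ζ x i))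
    (hγ : MemW1Inf Ω γ) (hγ_nonneg : ∀ᵐ x ∂volume.restrict Ω, 0 ≤ γ x)
    (hdiv : HasWeakDivergence Ω ζ divζ)
    (hγ₀ : 0 < γ₀) (hcoer : ∀ᵐ x ∂volume.restrict Ω, γ₀ ≤ γ x - (1 / 2) * divζ x)
    (σ M : ℝ) :
    ∃ C > 0, ∃ h₀ > 0,
      ∀ (𝒯 : Triangulation Ω) (e : Triangle → Plane → ℝ),
        𝒯.ShapeRegular σ → IsElementwiseW1Inf 𝒯 ε e M → 𝒯.meshSize ≤ h₀ →
        ∀ a_h : (Plane → ℝ) → (Plane → ℝ) → ℝ,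
          (a_h = eafeForm 𝒯 e ζ ∨ a_h = eafeReactionForm 𝒯 e ζ γ) →
          -- the discrete inf-sup condition
          (∀ p y : 𝒯.femSpace,
            BddAbove (range fun x : 𝒯.femSpace × 𝒯.femSpace =>
              saddleForm Ω a_h p y x.1 x.2 / (h1Norm Ω x.1 + h1Norm Ω x.2)) ∧
            C * (h1Norm Ω p + h1Norm Ω y) ≤
              ⨆ x : 𝒯.femSpace × 𝒯.femSpace,
                saddleForm Ω a_h p y x.1 x.2 / (h1Norm Ω x.1 + h1Norm Ω x.2)) ∧
          -- well-posedness of the discrete problem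
          (∀ y_d : Plane → ℝ, MemLp y_d 2 (volume.restrict Ω) →
            (∃! x : 𝒯.femSpace × 𝒯.femSpace, ∀ q z : 𝒯.femSpace,
              saddleForm Ω a_h x.1 x.2 q z = -l2Inner Ω y_d q) ∧
            ∀ p y : 𝒯.femSpace,
              (∀ q z : 𝒯.femSpace, saddleForm Ω a_h p y q z = -l2Inner Ω y_d q) →
              C * (h1Norm Ω p + h1Norm Ω y) ≤ l2Norm Ω y_d) := by
  obtain ⟨K, hK, h₀, hh₀, hgard⟩ := exists_eafeForm_garding hΩ hε₀ hε hζ_cont σ M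
  -- The constant `c / (4(1 + K))` of the abstract problem with `c = ε₀/2`; `K` and `h₀` were fixed
  -- before the mesh.
  refine ⟨ε₀ / 2 / (4 * (1 + K)), by positivity, h₀, hh₀, fun 𝒯 e hσ he hh a_h ha => ?_⟩
  obtain ⟨D, hD, hDb⟩ := Triangulation.exists_nodalEval_bound (𝒯 := 𝒯) hΩ
  have hN : ∀ v : 𝒯.femSpace, 0 ≤ h1Norm Ω v := fun v => Real.sqrt_nonneg _
  have hNq := Triangulation.h1Norm_combination_sq_le (𝒯 := 𝒯) hΩ
  have hm : ∀ u v, l2Bilin hΩ 𝒯 u v = l2Bilin hΩ 𝒯 v u := fun u v => by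
    simp only [l2Bilin_apply, l2Inner, mul_comm]
  have hγI := MemW1Inf.integrableOn_mul hΩ hγ
  -- Both forms satisfy Gårding's inequality with the same `K`, because the reaction term is
  -- nonnegative on the diagonal.
  obtain ⟨a, ha_eq, hG⟩ : ∃ a : 𝒯.femSpace →ₗ[ℝ] 𝒯.femSpace →ₗ[ℝ] ℝ,
      (∀ u v : 𝒯.femSpace, a_h u v = a u v) ∧
      ∀ v : 𝒯.femSpace, ε₀ / 2 * h1Norm Ω v ^ 2 ≤ a v v + K * l2Bilin hΩ 𝒯 v v := by
    rcases ha with rfl | rfl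
    · refine ⟨eafeBilin 𝒯 e ζ, fun _ _ => rfl, fun v => ?_⟩
      rw [l2Bilin_apply]
      exact hgard 𝒯 e hσ he hh v
    · refine ⟨eafeBilin 𝒯 e ζ + weightedBilin 𝒯 γ hγI, fun _ _ => rfl, fun v => ?_⟩
      have h1 : 0 ≤ weightedBilin 𝒯 γ hγI v v := by
        refine integral_nonneg_of_ae ?_
        filter_upwards [hγ_nonneg] with x hx
        rw [mul_assoc]
        exact mul_nonneg hx (mul_self_nonneg _)
      have h2 := hgard 𝒯 e hσ he hh v
      rw [l2Bilin_apply, LinearMap.add_apply, LinearMap.add_apply]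
      change _ ≤ eafeForm 𝒯 e ζ v v + _ + _
      linarith
  have hsad : ∀ p y q z : 𝒯.femSpace,
      saddleForm Ω a_h p y q z = saddleMap a (l2Bilin hΩ 𝒯) (p, y) (q, z) := fun p y q z => by
    rw [saddleMap_apply, saddleForm, ha_eq, ha_eq, l2Bilin_apply, l2Bilin_apply]
  have hε₂ : 0 < ε₀ / 2 := by positivity
  have hinj := Triangulation.nodalEval_injective (𝒯 := 𝒯)
  simp only [hsad]
  refine ⟨fun p y => ?_, fun y_d hy => ⟨?_, fun p y hpy => ?_⟩⟩
  · exact saddle_infSup a _ hm hN hNq hε₂ hK hG 𝒯.nodalEval hinj hD hDb (p, y)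
  · have h := saddle_existsUnique a _ hm hN hNq hε₂ hK hG 𝒯.nodalEval hinj hDb
      (dataFunctional hΩ 𝒯 hy)
    simp only [Prod.forall] at h
    exact h
  · refine saddle_apriori a _ hm hN hNq hε₂ hK hG (f := dataFunctional hΩ 𝒯 hy) (x := (p, y))
      (fun q => ?_) (Real.sqrt_nonneg _) fun w => hpy w.1 w.2
    change |-l2Inner Ω y_d q| ≤ _
    rw [abs_neg]
    exact (abs_l2Inner_le hy (memLp_two_of_continuous hΩ q.2.1)).trans
      (mul_le_mul_of_nonneg_left (l2Norm_le_h1Norm _) (Real.sqrt_nonneg _))
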